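/- Let $G$ be a (Hausdorff, finite-dimensional) Lie group with Lie algebra $\mathfrak g$, let $\rho\colon G\to \mathrm{End}_{\mathbb R}(\mathbb{R}^n)$ be a smooth linear representation of $G$, and let $\mathfrak g$ act on $\mathbb{R}^n$ by the differential of $\rho$ at the identity; write $\mathfrak g\ltimes\mathbb{R}^n$ for the semidirect product Lie algebra. Let $P$ be a Hausdorff smooth manifold with a smooth right action of $G$ that is proper, i.e. inverse images of compact sets under $P\times G\to P\times P$, $(p,g)\mapsto(p,p\cdot g)$, are compact. For $\xi\in\mathfrak g$ let $\bar\xi$ be the fundamental vector field, $\bar\xi_p=\frac{d}{dt}\big|_{t=0}\,p\cdot\exp(t\xi)$. Let $\varpi=\omega\oplus\alpha$ be a generalised $\mathfrak g\ltimes\mathbb{R}^n$-valued Cartan connection on $P$, i.e. a smooth $\mathfrak g\ltimes\mathbb{R}^n$-valued $1$-form such that $\varpi_p\colon T_pP\to\mathfrak g\ltimes\mathbb{R}^n$ is an isomorphism for every $p\in P$ and, for all $\xi\in\mathfrak g$, $$\varpi(\bar\xi)=\xi,\qquad \mathcal L_{\bar\xi}\varpi+\mathrm{ad}_\xi\varpi=0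 .$$ Assume that $G$ is connected, or else that the $\mathbb{R}^n$-component $\alpha$ of $\varpi$ is equivariant under the group $G$, i.e. $R_g^*\alpha=\rho(g)^{-1}\alpha$ for all $g\in G$, where $R_g(p)=p\cdot g$. For $p\in P$ let $G_p=\{g\in G: p\cdot g=p\}$ be the isotropy group. Pre-order the orbits by $[p\cdot G]\leqslant[q\cdot G]$ if and only if $G_q$ is conjugate to a subgroup of $G_p$. The principal isotropy groups are the groups $G_p$ of those points $p$ whose orbit is maximal for this pre-order, i.e. $[p\cdot G]\leqslant[q\cdot G]$ implies $[q\cdot G]\leqslant[p\cdot G]$ for every $q\in P$. Then every principal isotropy group of $P$ is contained in the kernel of $\rho\colon G\to\mathrm{End}_{\mathbb R}(\mathbb{R}^n)$. In particular, if $\rho$ is faithful, then all principal isotropy groups of $P$ are trivial. -/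

import Mathlib

open scoped Manifold ContDiff RightActions

noncomputable section

/-! Right `G`-manifolds. A right action of `G` on `P` is Mathlib's `MulAction Gᵐᵒᵖ P`, and
`p <• g` is the point `p · g`. -/

/-- The right action of the Lie group `G` on the manifold `P` is smooth: the map
`P × G → P, (p, g) ↦ p · g` is smooth. -/
def IsSmoothRightAction {E F : Type*} [NormedAddCommGroup E] [NormedSpace ℝ E]
    [NormedAddCommGroup F] [NormedSpace ℝ F]
    (G : Type*) [TopologicalSpace G] [ChartedSpace E G] [Group G]
    (P : Type*) [TopologicalSpace P] [ChartedSpace F P] [MulAction Gᵐᵒᵖ P] : Prop :=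
  ContMDiff (𝓘(ℝ, F).prod 𝓘(ℝ, E)) 𝓘(ℝ, F) ∞ (fun x : P × G => x.1 <• x.2)

/-- The right action of `G` on `P` is proper: inverse images of compact sets under
`P × G → P × P, (p, g) ↦ (p, p · g)` are compact. -/
def IsProperRightAction (G : Type*) [TopologicalSpace G] [Group G]
    (P : Type*) [TopologicalSpace P] [MulAction Gᵐᵒᵖ P] : Prop :=
  ∀ K : Set (P × P), IsCompact K →
    IsCompact ((fun x : P × G => (x.1, x.1 <• x.2)) ⁻¹' K)

/-- The isotropy group `G_p = {g | p · g = p}`. -/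
def isotropyGroup (G : Type*) [Group G] {P : Type*} [MulAction Gᵐᵒᵖ P] (p : P) : Subgroup G where
  carrier := {g | p <• g = p}
  one_mem' := by simp
  mul_mem' := by
    intro a b ha hb
    simp only [Set.mem_ofPred_eq] at *
    rw [op_smul_mul, ha, hb]
  inv_mem' := by
    intro a ha
    simp only [Set.mem_ofPred_eq] at *
    rw [MulOpposite.op_inv, inv_smul_eq_iff, ha]

/-- The pre-order `[p · G] ≤ [q · G]` on orbit types: the isotropy group `G_q` is conjugate to a
subgroup of `G_p`. This depends only on the orbits of `p` and `q`, indeed only on the conjugacy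
classes of their isotropy groups. -/
def OrbitTypeLE (G : Type*) [Group G] {P : Type*} [MulAction Gᵐᵒᵖ P] (p q : P) : Prop :=
  ∃ g : G, (isotropyGroup G q).map (MulAut.conj g).toMonoidHom ≤ isotropyGroup G p

/-- `p` lies on a principal orbit: the type of its orbit is maximal among the orbit types of `P`.
The isotropy groups of such points are the principal isotropy groups of `P`. -/
def IsPrincipalPoint (G : Type*) [Group G] {P : Type*} [MulAction Gᵐᵒᵖ P] (p : P) : Prop :=
  ∀ q : P, OrbitTypeLE G p q → OrbitTypeLE G q p

/-- The fundamental vector field `ξ̄` of the right action: `ξ̄ p` is the image of `ξ ∈ T₁G` under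
the differential at `1` of the orbit map `g ↦ p · g`. -/
def fundamentalField {E : Type*} (F : Type*) [NormedAddCommGroup E] [NormedSpace ℝ E]
    [NormedAddCommGroup F] [NormedSpace ℝ F]
    {G : Type*} [TopologicalSpace G] [ChartedSpace E G] [Group G]
    {P : Type*} [TopologicalSpace P] [ChartedSpace F P] [MulAction Gᵐᵒᵖ P]
    (ξ : GroupLieAlgebra 𝓘(ℝ, E) G) (p : P) : TangentSpace 𝓘(ℝ, F) p :=
  mfderiv 𝓘(ℝ, E) 𝓘(ℝ, F) (fun g : G => p <• g) 1 ξ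

/-! The Lie algebra `𝔤 ⋉ ℝⁿ`. The Lie algebra `𝔤 = T₁G` (with the bracket of left-invariant vector
fields) has `E` as its underlying vector space, so `𝔤 ⋉ ℝⁿ` has `E × ℝⁿ` as its underlying vector
space. -/

/-- The action of `𝔤` on `ℝⁿ` induced by a representation `ρ` of `G`: the differential of `ρ` at the
identity. -/
def infinitesimalRep {E : Type*} [NormedAddCommGroup E] [NormedSpace ℝ E]
    {G : Type*} [TopologicalSpace G] [ChartedSpace E G] [Group G] {n : ℕ}
    (ρ : G →* (EuclideanSpace ℝ (Fin n) →L[ℝ] EuclideanSpace ℝ (Fin n)))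
    (ξ : GroupLieAlgebra 𝓘(ℝ, E) G) : EuclideanSpace ℝ (Fin n) →L[ℝ] EuclideanSpace ℝ (Fin n) :=
  mfderiv 𝓘(ℝ, E) 𝓘(ℝ, EuclideanSpace ℝ (Fin n) →L[ℝ] EuclideanSpace ℝ (Fin n)) ρ 1 ξ

/-- An element `ξ` of `𝔤`, seen as the element `(ξ, 0)` of `𝔤 ⋉ ℝⁿ`. -/
def semidirectInl {E : Type*} [NormedAddCommGroup E] [NormedSpace ℝ E]
    {G : Type*} [TopologicalSpace G] [ChartedSpace E G] [Group G] (n : ℕ)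
    (ξ : GroupLieAlgebra 𝓘(ℝ, E) G) : E × EuclideanSpace ℝ (Fin n) :=
  Prod.mk (α := E) ξ 0

/-- The bracket of the Lie algebra `𝔤` of `G`. -/
def groupBracket {E : Type*} [NormedAddCommGroup E] [NormedSpace ℝ E]
    {G : Type*} [TopologicalSpace G] [ChartedSpace E G] [Group G]
    (ξ η : GroupLieAlgebra 𝓘(ℝ, E) G) : GroupLieAlgebra 𝓘(ℝ, E) G :=
  ⁅ξ, η⁆

/-- The bracket `[(ξ, u), (η, v)] = ([ξ, η], ξ · v - η · u)` of `𝔤 ⋉ ℝⁿ`. -/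
def semidirectBracket {E : Type*} [NormedAddCommGroup E] [NormedSpace ℝ E]
    {G : Type*} [TopologicalSpace G] [ChartedSpace E G] [Group G] {n : ℕ}
    (ρ : G →* (EuclideanSpace ℝ (Fin n) →L[ℝ] EuclideanSpace ℝ (Fin n)))
    (x y : E × EuclideanSpace ℝ (Fin n)) : E × EuclideanSpace ℝ (Fin n) :=
  Prod.mk (α := E) (groupBracket (G := G) x.1 y.1)
    (infinitesimalRep ρ x.1 y.2 - infinitesimalRep ρ y.1 x.2)

/-! Vector-valued `1`-forms. -/

/-- A `W`-valued `1`-form `θ` on `P` is smooth: it is smooth as a map `TP → W`. -/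
def IsSmoothOneForm {F W : Type*} [NormedAddCommGroup F] [NormedSpace ℝ F]
    [NormedAddCommGroup W] [NormedSpace ℝ W]
    {P : Type*} [TopologicalSpace P] [ChartedSpace F P] [IsManifold 𝓘(ℝ, F) ∞ P]
    (θ : ∀ p : P, TangentSpace 𝓘(ℝ, F) p →L[ℝ] W) : Prop :=
  ContMDiff 𝓘(ℝ, F).tangent 𝓘(ℝ, W) ∞
    (fun v : TangentBundle 𝓘(ℝ, F) P => θ v.proj v.snd)

/-- The value at `p` of the function `(𝓛_X θ)(Y) = X (θ(Y)) - θ([X, Y])`, where `𝓛_X θ` is the Lie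
derivative of the `W`-valued `1`-form `θ` along the vector field `X`. -/
def lieDerivativeOneForm {F W : Type*} [NormedAddCommGroup F] [NormedSpace ℝ F]
    [NormedAddCommGroup W] [NormedSpace ℝ W]
    {P : Type*} [TopologicalSpace P] [ChartedSpace F P]
    (X : ∀ p : P, TangentSpace 𝓘(ℝ, F) p)
    (θ : ∀ p : P, TangentSpace 𝓘(ℝ, F) p →L[ℝ] W)
    (Y : ∀ p : P, TangentSpace 𝓘(ℝ, F) p) (p : P) : W :=
  NormedSpace.fromTangentSpace (θ p (Y p))
      (mfderiv 𝓘(ℝ, F) 𝓘(ℝ, W) (fun q => θ q (Y q)) p (X p))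
    - θ p (VectorField.mlieBracket 𝓘(ℝ, F) X Y p)

/-- A generalised `𝔤 ⋉ ℝⁿ`-valued Cartan connection on the right `G`-manifold `P`, where `𝔤` acts on
`ℝⁿ` through the differential of the representation `ρ` of `G`: a smooth nondegenerate
`𝔤 ⋉ ℝⁿ`-valued `1`-form `ϖ` with `ϖ(ξ̄) = ξ` and `𝓛_ξ̄ ϖ + ad_ξ ϖ = 0` for all `ξ ∈ 𝔤`. -/
structure IsGeneralisedCartanConnection {E F : Type*} [NormedAddCommGroup E] [NormedSpace ℝ E]
    [NormedAddCommGroup F] [NormedSpace ℝ F]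
    {G : Type*} [TopologicalSpace G] [ChartedSpace E G] [Group G]
    {P : Type*} [TopologicalSpace P] [ChartedSpace F P] [IsManifold 𝓘(ℝ, F) ∞ P]
    [MulAction Gᵐᵒᵖ P] {n : ℕ}
    (ρ : G →* (EuclideanSpace ℝ (Fin n) →L[ℝ] EuclideanSpace ℝ (Fin n)))
    (ϖ : ∀ p : P, TangentSpace 𝓘(ℝ, F) p →L[ℝ] E × EuclideanSpace ℝ (Fin n)) : Prop where
  smooth : IsSmoothOneForm ϖ
  nondegenerate : ∀ p : P, Function.Bijective (ϖ p)
  normalised : ∀ (ξ : GroupLieAlgebra 𝓘(ℝ, E) G) (p : P),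
    ϖ p (fundamentalField F ξ p) = semidirectInl n ξ
  equivariant : ∀ (ξ : GroupLieAlgebra 𝓘(ℝ, E) G) (Y : ∀ p : P, TangentSpace 𝓘(ℝ, F) p) (p : P),
    ContMDiffAt 𝓘(ℝ, F) 𝓘(ℝ, F).tangent ∞
      (fun q => (⟨q, Y q⟩ : TangentBundle 𝓘(ℝ, F) P)) p →
    lieDerivativeOneForm (fundamentalField F ξ) ϖ Y p
      + semidirectBracket ρ (semidirectInl n ξ) (ϖ p (Y p)) = 0

/-- The `ℝⁿ`-component `α` of `ϖ` is equivariant under the group `G`: `R_g^* α = g⁻¹ · α` for all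
`g ∈ G`, where `R_g` is the map `p ↦ p · g`. -/
def IsGroupEquivariantSolder {E F : Type*} [NormedAddCommGroup E] [NormedSpace ℝ E]
    [NormedAddCommGroup F] [NormedSpace ℝ F]
    {G : Type*} [Group G]
    {P : Type*} [TopologicalSpace P] [ChartedSpace F P] [MulAction Gᵐᵒᵖ P] {n : ℕ}
    (ρ : G →* (EuclideanSpace ℝ (Fin n) →L[ℝ] EuclideanSpace ℝ (Fin n)))
    (ϖ : ∀ p : P, TangentSpace 𝓘(ℝ, F) p →L[ℝ] E × EuclideanSpace ℝ (Fin n)) : Prop :=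
  ∀ (g : G) (p : P) (v : TangentSpace 𝓘(ℝ, F) p),
    (ϖ (p <• g) (mfderiv 𝓘(ℝ, F) 𝓘(ℝ, F) (fun q : P => q <• g) p v)).2 = ρ g⁻¹ (ϖ p v).2

end

noncomputable section

open Filter Topology

/-! Fix a principal point `p` with isotropy group `H`. The `𝔤`-component of `ϖ` at `p` is a linear
left inverse of `ξ ↦ ξ̄ p`, so the action is locally free at `p`; with properness `H` is compact and
discrete, hence finite (`finite_isotropyGroup`).

Choose a function `f₀` near `p` with `f₀ p = 0` whose differential at `p` is this component, and
average it over `H`, twisting by the adjoint representation (`exists_equivariant_map`). The zero set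
of the resulting `f` is `H`-invariant and transverse to the orbit, and it acts as a slice: its
points near `p` have isotropy group inside `H` (`eventually_isotropyGroup_le`). Since `p` is
principal and `H` is finite, these groups equal `H`. Hence `H` fixes the zero set pointwise near
`p`, and the differential at `p` of each translation by `h ∈ H` is the identity on the kernel of
`df` at `p` (`mfderiv_translation_eq_self`).

That kernel is complementary to the orbit directions, on which `α` vanishes, so `α` maps it onto
`ℝⁿ`. For `v` in the kernel, group equivariance gives `α(v) = α(dR_h v) = ρ(h)⁻¹ α(v)`, so `ρ(h) =
1`.

For connected `G`, group equivariance of `α` is derived from the infinitesimal condition: `g ↦ ρ(g)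
(R_g^* α)(w)` has zero derivative at `1` by the Lie derivative formula
`exists_mfderiv_pullbackTranslation`, then everywhere by translation, so it is constant. Orbit maps
are differentiated directly, without flows or the exponential map. -/

/-! ### Local parametrizations of a boundaryless manifold -/

/-- `c` is a smooth parametrization of a neighbourhood of `c x₀`, with local inverse `e`. -/
structure IsLocalParam {F : Type*} [NormedAddCommGroup F] [NormedSpace ℝ F]
    {P : Type*} [TopologicalSpace P] [ChartedSpace F P] (c : F → P) (e : P → F) (x₀ : F) :
    Prop where
  smooth : ∀ᶠ x in 𝓝 x₀, ContMDiffAt 𝓘(ℝ, F) 𝓘(ℝ, F) ∞ c x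
  smooth_inv : ∀ᶠ q in 𝓝 (c x₀), ContMDiffAt 𝓘(ℝ, F) 𝓘(ℝ, F) ∞ e q
  left_inv : ∀ᶠ x in 𝓝 x₀, e (c x) = x
  right_inv : ∀ᶠ q in 𝓝 (c x₀), c (e q) = q

section LocalParam

variable {F : Type*} [NormedAddCommGroup F] [NormedSpace ℝ F]
  {P : Type*} [TopologicalSpace P] [ChartedSpace F P]

theorem exists_isLocalParam [IsManifold 𝓘(ℝ, F) ∞ P] (p : P) :
    ∃ (c : F → P) (e : P → F) (x₀ : F), c x₀ = p ∧ IsLocalParam c e x₀ := by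
  have hp : (extChartAt 𝓘(ℝ, F) p).symm (extChartAt 𝓘(ℝ, F) p p) = p := extChartAt_to_inv p
  have ht : (extChartAt 𝓘(ℝ, F) p).target ∈ 𝓝 (extChartAt 𝓘(ℝ, F) p p) :=
    extChartAt_target_mem_nhds p
  refine ⟨(extChartAt 𝓘(ℝ, F) p).symm, extChartAt 𝓘(ℝ, F) p, extChartAt 𝓘(ℝ, F) p p, hp, ?_⟩
  constructor
  · filter_upwards [eventually_mem_nhds_iff.2 ht] with x hx
    exact (contMDiffOn_extChartAt_symm p).contMDiffAt hx
  · rw [hp]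
    filter_upwards [chart_source_mem_nhds F p] with q hq
    exact contMDiffAt_extChartAt' hq
  · filter_upwards [ht] with x hx using (extChartAt 𝓘(ℝ, F) p).right_inv hx
  · rw [hp]
    filter_upwards [extChartAt_source_mem_nhds (I := 𝓘(ℝ, F)) p] with q hq
    exact (extChartAt 𝓘(ℝ, F) p).left_inv hq

variable {c : F → P} {e : P → F} {x₀ : F}

namespace IsLocalParam

theorem contMDiffAt (h : IsLocalParam c e x₀) : ContMDiffAt 𝓘(ℝ, F) 𝓘(ℝ, F) ∞ c x₀ :=
  h.smooth.self_of_nhds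

theorem contMDiffAt_inv (h : IsLocalParam c e x₀) :
    ContMDiffAt 𝓘(ℝ, F) 𝓘(ℝ, F) ∞ e (c x₀) :=
  h.smooth_inv.self_of_nhds

theorem mdifferentiableAt (h : IsLocalParam c e x₀) : MDifferentiableAt 𝓘(ℝ, F) 𝓘(ℝ, F) c x₀ :=
  h.contMDiffAt.mdifferentiableAt (by simp)

theorem mdifferentiableAt_inv (h : IsLocalParam c e x₀) :
    MDifferentiableAt 𝓘(ℝ, F) 𝓘(ℝ, F) e (c x₀) :=
  h.contMDiffAt_inv.mdifferentiableAt (by simp)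

theorem inv_apply (h : IsLocalParam c e x₀) : e (c x₀) = x₀ := h.left_inv.self_of_nhds

theorem eventually (h : IsLocalParam c e x₀) : ∀ᶠ x in 𝓝 x₀, IsLocalParam c e x := by
  have hc := h.contMDiffAt.continuousAt
  filter_upwards [eventually_eventually_nhds.2 h.smooth,
    hc.eventually (eventually_eventually_nhds.2 h.smooth_inv),
    eventually_eventually_nhds.2 h.left_inv,
    hc.eventually (eventually_eventually_nhds.2 h.right_inv)] with x h₁ h₂ h₃ h₄
  exact ⟨h₁, h₂, h₃, h₄⟩

theorem mfderiv_inv_mfderiv (h : IsLocalParam c e x₀) (v : TangentSpace 𝓘(ℝ, F) x₀) :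
    mfderiv 𝓘(ℝ, F) 𝓘(ℝ, F) e (c x₀) (mfderiv 𝓘(ℝ, F) 𝓘(ℝ, F) c x₀ v) = v := by
  refine (mfderiv_comp_apply x₀ h.mdifferentiableAt_inv h.mdifferentiableAt v).symm.trans ?_
  have : e ∘ c =ᶠ[𝓝 x₀] id := h.left_inv
  rw [this.mfderiv_eq, mfderiv_id]
  rfl

theorem mfderiv_mfderiv_inv (h : IsLocalParam c e x₀) (v : TangentSpace 𝓘(ℝ, F) (c x₀)) :
    mfderiv 𝓘(ℝ, F) 𝓘(ℝ, F) c x₀ (mfderiv 𝓘(ℝ, F) 𝓘(ℝ, F) e (c x₀) v) = v := by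
  refine (mfderiv_comp_apply_of_eq (c x₀) h.mdifferentiableAt h.mdifferentiableAt_inv
    h.inv_apply v).symm.trans ?_
  have : c ∘ e =ᶠ[𝓝 (c x₀)] id := h.right_inv
  rw [this.mfderiv_eq, mfderiv_id]
  rfl

theorem isInvertible_mfderiv (h : IsLocalParam c e x₀) :
    (mfderiv 𝓘(ℝ, F) 𝓘(ℝ, F) c x₀).IsInvertible :=
  ⟨ContinuousLinearEquiv.equivOfInverse (mfderiv 𝓘(ℝ, F) 𝓘(ℝ, F) c x₀)
    (mfderiv 𝓘(ℝ, F) 𝓘(ℝ, F) e (c x₀)) h.mfderiv_inv_mfderiv h.mfderiv_mfderiv_inv, rfl⟩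

theorem injective_mfderiv (h : IsLocalParam c e x₀) :
    Function.Injective (mfderiv 𝓘(ℝ, F) 𝓘(ℝ, F) c x₀) :=
  Function.LeftInverse.injective h.mfderiv_inv_mfderiv

/-- The differential of a local parametrization is a smooth map from `F × F` to the tangent
bundle. -/
theorem contMDiffAt_tangentMap [IsManifold 𝓘(ℝ, F) ∞ P] (h : IsLocalParam c e x₀) (v : F) :
    ContMDiffAt 𝓘(ℝ, F × F) 𝓘(ℝ, F).tangent ∞
      (fun z : F × F => (⟨c z.1, mfderiv 𝓘(ℝ, F) 𝓘(ℝ, F) c z.1 z.2⟩ :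
        TangentBundle 𝓘(ℝ, F) P)) (x₀, v) := by
  obtain ⟨U, hU, hUo, hxU⟩ := eventually_nhds_iff.1 h.smooth
  have h1 : ContMDiffOn 𝓘(ℝ, F) 𝓘(ℝ, F) ∞ c U := fun x hx => (hU x hx).contMDiffWithinAt
  have h2 := h1.contMDiffOn_tangentMapWithin (m := ∞) (by simp) hUo.uniqueMDiffOn
  have h3 : ContMDiffAt 𝓘(ℝ, F × F) 𝓘(ℝ, F).tangent ∞
      (fun z : F × F => (⟨z.1, z.2⟩ : TangentBundle 𝓘(ℝ, F) F)) (x₀, v) := by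
    rw [Bundle.contMDiffAt_totalSpace]
    refine ⟨contDiff_fst.contMDiff.contMDiffAt, ?_⟩
    simpa using contDiff_snd.contMDiff.contMDiffAt
  have h4 : ContMDiffAt 𝓘(ℝ, F).tangent 𝓘(ℝ, F).tangent ∞
      (tangentMapWithin 𝓘(ℝ, F) 𝓘(ℝ, F) c U) (⟨x₀, v⟩ : TangentBundle 𝓘(ℝ, F) F) :=
    h2.contMDiffAt ((hUo.preimage (FiberBundle.continuous_proj F _)).mem_nhds hxU)
  refine (ContMDiffAt.comp (x₀, v) h4 h3).congr_of_eventuallyEq ?_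
  filter_upwards [continuousAt_fst.eventually (hUo.mem_nhds hxU)] with z hz
  simp only [Function.comp_apply, tangentMapWithin]
  rw [mfderivWithin_of_isOpen hUo hz]

/-- A vector field with smooth coordinates is smooth. -/
theorem contMDiffAt_vectorField [IsManifold 𝓘(ℝ, F) ∞ P] (h : IsLocalParam c e x₀) {X : F → F}
    (hX : ContDiffAt ℝ ∞ X x₀) {Y : ∀ q : P, TangentSpace 𝓘(ℝ, F) q}
    (hY : ∀ᶠ x in 𝓝 x₀, Y (c x) = mfderiv 𝓘(ℝ, F) 𝓘(ℝ, F) c x (X x)) :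
    ContMDiffAt 𝓘(ℝ, F) 𝓘(ℝ, F).tangent ∞
      (fun q => (⟨q, Y q⟩ : TangentBundle 𝓘(ℝ, F) P)) (c x₀) := by
  have h1 : ContMDiffAt 𝓘(ℝ, F) 𝓘(ℝ, F × F) ∞ (fun q => (e q, X (e q))) (c x₀) := by
    refine h.contMDiffAt_inv.prodMk_space ?_
    refine ContMDiffAt.comp (I' := 𝓘(ℝ, F)) (c x₀) (g := X) ?_ h.contMDiffAt_inv
    rw [h.inv_apply]; exact hX.contMDiffAt
  have h2 : ContMDiffAt 𝓘(ℝ, F × F) 𝓘(ℝ, F).tangent ∞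
      (fun z : F × F => (⟨c z.1, mfderiv 𝓘(ℝ, F) 𝓘(ℝ, F) c z.1 z.2⟩ :
        TangentBundle 𝓘(ℝ, F) P)) (e (c x₀), X (e (c x₀))) := by
    rw [h.inv_apply]; exact h.contMDiffAt_tangentMap _
  refine (ContMDiffAt.comp (c x₀) h2 h1).congr_of_eventuallyEq ?_
  have he : Tendsto e (𝓝 (c x₀)) (𝓝 x₀) := by
    have := h.contMDiffAt_inv.continuousAt
    rwa [ContinuousAt, h.inv_apply] at this
  filter_upwards [h.right_inv, he.eventually hY] with q hq hq'
  simp only [Function.comp_apply]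
  rw [← hq', hq]

theorem contDiffAt_oneForm [IsManifold 𝓘(ℝ, F) ∞ P] (h : IsLocalParam c e x₀)
    {W : Type*} [NormedAddCommGroup W] [NormedSpace ℝ W]
    {θ : ∀ p : P, TangentSpace 𝓘(ℝ, F) p →L[ℝ] W} (hθ : IsSmoothOneForm θ) (v : F) :
    ContDiffAt ℝ ∞ (fun z : F × F => θ (c z.1) (mfderiv 𝓘(ℝ, F) 𝓘(ℝ, F) c z.1 z.2)) (x₀, v) :=
  (ContMDiffAt.comp (x₀, v) hθ.contMDiffAt (h.contMDiffAt_tangentMap v)).contDiffAt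

end IsLocalParam

end LocalParam

/-! ### Local freeness of the action -/

/-- In finite dimension an injective endomorphism is invertible, so the inverse function theorem
applies. -/
theorem exists_nhds_injOn_of_injective_fderiv {V : Type*} [NormedAddCommGroup V] [NormedSpace ℝ V]
    [FiniteDimensional ℝ V] {f : V → V} {a : V} (hf : ContDiffAt ℝ 1 f a)
    (hinj : Function.Injective (fderiv ℝ f a)) : ∃ U ∈ 𝓝 a, Set.InjOn f U := by
  have : CompleteSpace V := FiniteDimensional.complete ℝ V
  have hstrict := hf.hasStrictFDerivAt one_ne_zero
  let L : V ≃L[ℝ] V :=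
    (LinearEquiv.ofInjectiveEndo (fderiv ℝ f a : V →ₗ[ℝ] V) hinj).toContinuousLinearEquiv
  have hL : HasStrictFDerivAt f (L : V →L[ℝ] V) a := by
    convert! hstrict using 1
  refine ⟨(hL.toOpenPartialHomeomorph f).source,
    (hL.toOpenPartialHomeomorph f).open_source.mem_nhds hL.mem_toOpenPartialHomeomorph_source, ?_⟩
  have := (hL.toOpenPartialHomeomorph f).injOn
  simpa using this

section Action

variable {E F : Type*} [NormedAddCommGroup E] [NormedSpace ℝ E]
  [NormedAddCommGroup F] [NormedSpace ℝ F]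
  {G : Type*} [TopologicalSpace G] [ChartedSpace E G] [Group G]
  {P : Type*} [TopologicalSpace P] [ChartedSpace F P] [MulAction Gᵐᵒᵖ P]

theorem IsSmoothRightAction.contMDiff_orbit (h : IsSmoothRightAction (E := E) (F := F) G P)
    (p : P) : ContMDiff 𝓘(ℝ, E) 𝓘(ℝ, F) ∞ (fun g : G => p <• g) :=
  ContMDiff.comp h (contMDiff_const.prodMk contMDiff_id)

theorem IsSmoothRightAction.contMDiff_translation
    (h : IsSmoothRightAction (E := E) (F := F) G P) (g : G) :
    ContMDiff 𝓘(ℝ, F) 𝓘(ℝ, F) ∞ (fun p : P => p <• g) :=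
  ContMDiff.comp (f := fun p : P => (p, g)) (g := fun x : P × G => x.1 <• x.2) h
    (contMDiff_id.prodMk contMDiff_const)

theorem IsSmoothRightAction.continuous (h : IsSmoothRightAction (E := E) (F := F) G P) :
    Continuous (fun x : P × G => x.1 <• x.2) :=
  ContMDiff.continuous h

theorem IsSmoothRightAction.contMDiffAt_param (h : IsSmoothRightAction (E := E) (F := F) G P)
    {c : F → P} {x : F} (hc : ContMDiffAt 𝓘(ℝ, F) 𝓘(ℝ, F) ∞ c x)
    {d : E → G} {y : E} (hd : ContMDiffAt 𝓘(ℝ, E) 𝓘(ℝ, E) ∞ d y) :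
    ContMDiffAt 𝓘(ℝ, F × E) 𝓘(ℝ, F) ∞ (fun z : F × E => c z.1 <• d z.2) (x, y) := by
  have h1 : ContMDiffAt 𝓘(ℝ, F × E) 𝓘(ℝ, F) ∞ (fun z : F × E => c z.1) (x, y) :=
    ContMDiffAt.comp (I' := 𝓘(ℝ, F)) (x, y) (g := c) hc contDiff_fst.contMDiff.contMDiffAt
  have h2 : ContMDiffAt 𝓘(ℝ, F × E) 𝓘(ℝ, E) ∞ (fun z : F × E => d z.2) (x, y) :=
    ContMDiffAt.comp (I' := 𝓘(ℝ, E)) (x, y) (g := d) hd contDiff_snd.contMDiff.contMDiffAt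
  exact ContMDiffAt.comp (x, y) h.contMDiffAt (h1.prodMk h2)

/-- If the differential of `f` at `p` inverts the fundamental vector fields, then `f` is injective
on small pieces of orbits, uniformly near `p`. -/
theorem exists_nhds_orbit_injective [FiniteDimensional ℝ E] [FiniteDimensional ℝ F]
    [IsManifold 𝓘(ℝ, E) ∞ G] [IsManifold 𝓘(ℝ, F) ∞ P]
    (hs : IsSmoothRightAction (E := E) (F := F) G P) {f : P → E} {p : P}
    (hf : ContMDiffAt 𝓘(ℝ, F) 𝓘(ℝ, E) ∞ f p)
    (hB : ∀ ξ : GroupLieAlgebra 𝓘(ℝ, E) G,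
      mfderiv 𝓘(ℝ, F) 𝓘(ℝ, E) f p (fundamentalField F ξ p) = ξ) :
    ∃ U ∈ 𝓝 p, ∃ W ∈ 𝓝 (1 : G), ∀ q ∈ U, ∀ u ∈ W, ∀ u' ∈ W, f (q <• u) = f (q <• u') → u = u' := by
  obtain ⟨c, e, x₀, rfl, hc⟩ := exists_isLocalParam (F := F) p
  obtain ⟨d, d', y₀, hy₀, hd⟩ := exists_isLocalParam (F := E) (1 : G)
  have hact := hs.contMDiffAt_param hc.contMDiffAt hd.contMDiffAt
  have hact0 : c x₀ <• d y₀ = c x₀ := by simp [hy₀]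
  let φ : F × E → E := fun z => f (c z.1 <• d z.2)
  have hφ : ContDiffAt ℝ ∞ φ (x₀, y₀) := by
    rw [← contMDiffAt_iff_contDiffAt]
    exact ContMDiffAt.comp (x₀, y₀) (g := f) (by rw [hact0]; exact hf) hact
  -- Keeping the base point as a first component makes the differential block triangular, and
  -- injectivity of `Ψ` near `(x₀, y₀)` is injectivity along orbits, uniform in the base point.
  let Ψ : F × E → F × E := fun z => (z.1, φ z)
  have hΨ : ContDiffAt ℝ ∞ Ψ (x₀, y₀) := contDiffAt_fst.prodMk hφ
  have hφd : HasFDerivAt φ (fderiv ℝ φ (x₀, y₀)) (x₀, y₀) :=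
    (hφ.differentiableAt (by simp)).hasFDerivAt
  have hφ2 : ∀ η : E, fderiv ℝ φ (x₀, y₀) (0, η) = mfderiv 𝓘(ℝ, E) 𝓘(ℝ, E) d y₀ η := by
    intro η
    have h1 : HasFDerivAt (fun y => φ (x₀, y)) _ y₀ :=
      HasFDerivAt.comp (g := φ) (f := fun y => (x₀, y)) y₀ hφd (hasFDerivAt_prodMk_right x₀ y₀)
    have h2 : fderiv ℝ φ (x₀, y₀) (0, η) = fderiv ℝ (fun y => φ (x₀, y)) y₀ η := by
      rw [h1.fderiv]; simp
    rw [h2, ← mfderiv_eq_fderiv]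
    have ho := (hs.contMDiff_orbit (c x₀)).mdifferentiable (by simp)
    refine (mfderiv_comp_apply_of_eq (f := fun y => c x₀ <• d y) (g := f) y₀
      (hf.mdifferentiableAt (by simp)) ((ho _).comp y₀ hd.mdifferentiableAt) hact0 η).trans ?_
    have h3 : mfderiv 𝓘(ℝ, E) 𝓘(ℝ, F) (fun y => c x₀ <• d y) y₀ η
        = fundamentalField F (G := G) (mfderiv 𝓘(ℝ, E) 𝓘(ℝ, E) d y₀ η) (c x₀) :=
      mfderiv_comp_apply_of_eq (f := d) (g := fun g : G => c x₀ <• g) y₀ (ho 1)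
        hd.mdifferentiableAt hy₀ η
    rw [← hB (mfderiv 𝓘(ℝ, E) 𝓘(ℝ, E) d y₀ η)]
    exact congrArg (mfderiv 𝓘(ℝ, F) 𝓘(ℝ, E) f (c x₀)) h3
  have hinj : Function.Injective (fderiv ℝ Ψ (x₀, y₀)) := by
    have hΨd : fderiv ℝ Ψ (x₀, y₀) = (ContinuousLinearMap.fst ℝ F E).prod (fderiv ℝ φ (x₀, y₀)) :=
      (hasFDerivAt_fst.prodMk hφd).fderiv
    rw [hΨd, injective_iff_map_eq_zero]
    rintro ⟨v, η⟩ h0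
    have hv : v = 0 := congrArg Prod.fst h0
    subst hv
    have hη : mfderiv 𝓘(ℝ, E) 𝓘(ℝ, E) d y₀ η = 0 := (hφ2 η).symm.trans (congrArg Prod.snd h0)
    have : η = 0 := hd.injective_mfderiv (hη.trans (map_zero _).symm)
    rw [this]; rfl
  obtain ⟨N, hN, hNinj⟩ := exists_nhds_injOn_of_injective_fderiv (hΨ.of_le (by simp)) hinj
  obtain ⟨U, hU, W, hW, hUW⟩ := mem_nhds_prod_iff.1 hN
  have he : Tendsto e (𝓝 (c x₀)) (𝓝 x₀) := by
    have := hc.contMDiffAt_inv.continuousAt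
    rwa [ContinuousAt, hc.inv_apply] at this
  have hd' : Tendsto d' (𝓝 1) (𝓝 y₀) := by
    have := hd.contMDiffAt_inv.continuousAt
    rwa [ContinuousAt, hd.inv_apply, hy₀] at this
  have hdr := hd.right_inv
  rw [hy₀] at hdr
  refine ⟨_, inter_mem (he hU) hc.right_inv, _, inter_mem (hd' hW) hdr, ?_⟩
  rintro q ⟨hq, hq'⟩ u ⟨hu, hu'⟩ u' ⟨hv, hv'⟩ huv
  have key := hNinj (hUW (Set.mk_mem_prod hq hu)) (hUW (Set.mk_mem_prod hq hv)) (by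
    change (e q, f (c (e q) <• d (d' u))) = (e q, f (c (e q) <• d (d' u')))
    rw [Set.mem_ofPred_eq] at hu' hv' hq'
    rw [hu', hv', hq', huv])
  have h5 : d' u = d' u' := congrArg Prod.snd key
  rw [← hu', ← hv', h5]

end Action

/-! ### Isotropy groups near a point -/

theorem mem_isotropyGroup {G P : Type*} [Group G] [MulAction Gᵐᵒᵖ P] {p : P} {g : G} :
    g ∈ isotropyGroup G p ↔ p <• g = p := Iff.rfl

/-- Maximality puts a conjugate of the larger group inside the smaller one, and counting elements
forces equality. Finiteness matters: an infinite group can be conjugate to a proper subgroup of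
itself. -/
theorem IsPrincipalPoint.isotropyGroup_eq {G P : Type*} [Group G] [MulAction Gᵐᵒᵖ P] {p s : P}
    (hp : IsPrincipalPoint G p) [Finite (isotropyGroup G p)]
    (hs : isotropyGroup G s ≤ isotropyGroup G p) : isotropyGroup G s = isotropyGroup G p := by
  obtain ⟨g, hg⟩ := hp s ⟨1, by rintro _ ⟨x, hx, rfl⟩; simpa using hs hx⟩
  have hcard : Nat.card ((isotropyGroup G p).map (MulAut.conj g).toMonoidHom) =
      Nat.card (isotropyGroup G p) :=
    Subgroup.card_map_of_injective (MulAut.conj g).injective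
  have : Finite (isotropyGroup G s) := Finite.of_injective _ (Subgroup.inclusion_injective hs)
  exact Subgroup.eq_of_le_of_card_ge hs (hcard ▸ Subgroup.card_le_of_le hg)

/-! ### Consequences of properness: finite isotropy, semicontinuity, slices. -/

section Topological

variable {G : Type*} [TopologicalSpace G] [Group G]
  {P : Type*} [TopologicalSpace P] [MulAction Gᵐᵒᵖ P]

theorem isCompact_isotropyGroup (hp : IsProperRightAction G P) (p : P) :
    IsCompact (isotropyGroup G p : Set G) := by
  have h := (hp {(p, p)} isCompact_singleton).image continuous_snd
  convert! h using 1
  ext g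
  constructor
  · intro hg
    exact ⟨(p, g), by simpa using mem_isotropyGroup.1 hg, rfl⟩
  · rintro ⟨⟨q, g'⟩, hq, rfl⟩
    obtain ⟨rfl, h2⟩ := Prod.mk.inj hq
    exact h2

/-- Each translate `g W` with `g` in the isotropy group meets that group only in `g`, and
compactness leaves finitely many translates. -/
theorem finite_isotropyGroup [IsTopologicalGroup G] (hp : IsProperRightAction G P) (p : P)
    {W : Set G} (hW : W ∈ 𝓝 1) (hWp : ∀ u ∈ W, p <• u = p → u = 1) :
    Finite (isotropyGroup G p) := by
  obtain ⟨t, htp, ht⟩ := (isCompact_isotropyGroup hp p).elim_nhds_subcover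
    (fun g => (fun x => g⁻¹ * x) ⁻¹' W) (fun g _ => by
      refine (continuous_const_mul g⁻¹).continuousAt.preimage_mem_nhds ?_
      simpa using hW)
  refine (t.finite_toSet.biUnion (t := fun g => {h | h ∈ isotropyGroup G p ∧ g⁻¹ * h ∈ W})
    fun g hgt => Set.Subsingleton.finite ?_).subset ?_ |>.to_subtype
  · have hgp := htp g hgt
    have key : ∀ h ∈ isotropyGroup G p, g⁻¹ * h ∈ W → h = g := fun h hh hW' =>
      (inv_mul_eq_one.1 (hWp _ hW' (mul_mem (inv_mem hgp) hh))).symm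
    rintro a ⟨ha, ha'⟩ b ⟨hb, hb'⟩
    rw [key a ha ha', key b hb hb']
  · intro h hh
    obtain ⟨g, hg, hgh⟩ := Set.mem_iUnion₂.1 (ht hh)
    exact Set.mem_iUnion₂.2 ⟨g, hg, hh, hgh⟩

/-- For `q` near `p`, the isotropy group of `q` is near that of `p`. -/
theorem eventually_isotropyGroup_subset [T2Space P] [LocallyCompactSpace P]
    (hp : IsProperRightAction G P)
    (hc : Continuous (fun x : P × G => x.1 <• x.2)) {p : P} {O : Set G} (hO : IsOpen O)
    (hpO : (isotropyGroup G p : Set G) ⊆ O) :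
    ∀ᶠ q in 𝓝 p, (isotropyGroup G q : Set G) ⊆ O := by
  obtain ⟨C, hC, hCp⟩ := exists_compact_mem_nhds p
  have hT := hp (C ×ˢ C) (hC.prod hC)
  have hZ : IsClosed {x : P × G | x.1 <• x.2 = x.1 ∧ x.2 ∉ O} :=
    (isClosed_eq hc continuous_fst).inter (hO.isClosed_compl.preimage continuous_snd)
  -- The pairs `(q, g)` with `q` in `C`, `q · g = q` and `g ∉ O` form a compact set; its projection
  -- to `P` is therefore closed, and it misses `p`.
  have hcl := ((hT.inter_right hZ).image continuous_fst).isClosed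
  have hmem : p ∉ Prod.fst '' ((fun x : P × G => (x.1, x.1 <• x.2)) ⁻¹' C ×ˢ C ∩
      {x : P × G | x.1 <• x.2 = x.1 ∧ x.2 ∉ O}) := by
    rintro ⟨⟨q, g⟩, ⟨-, hq, hg⟩, rfl⟩
    exact hg (hpO hq)
  filter_upwards [hcl.isOpen_compl.mem_nhds hmem, hCp] with q hq hqC g hg
  by_contra hgO
  have hg' : q <• g = q := hg
  exact hq ⟨(q, g), ⟨⟨hqC, by simpa [hg'] using hqC⟩, hg', hgO⟩, rfl⟩

/-- An equivariant map that is injective on small pieces of orbits defines a slice: points near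
`p` in its zero set have isotropy group contained in that of `p`. -/
theorem eventually_isotropyGroup_le {E : Type*} [Zero E] [IsTopologicalGroup G] [T2Space P]
    [LocallyCompactSpace P]
    (hp : IsProperRightAction G P)
    (hc : Continuous (fun x : P × G => x.1 <• x.2)) {p : P} [Finite (isotropyGroup G p)]
    {f : P → E} {U : Set P} (hU : U ∈ 𝓝 p) {W : Set G} (hW : W ∈ 𝓝 1)
    (hinj : ∀ q ∈ U, ∀ u ∈ W, ∀ u' ∈ W, f (q <• u) = f (q <• u') → u = u')
    (hf : ∀ h ∈ isotropyGroup G p, ∀ q, f q = 0 → f (q <• h) = 0) :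
    ∀ᶠ s in 𝓝 p, f s = 0 → isotropyGroup G s ≤ isotropyGroup G p := by
  have h1 : ∀ h : isotropyGroup G p, ∀ᶠ s in 𝓝 p, s <• (h : G) ∈ U := by
    intro h
    have hcont : Continuous (fun s : P => s <• (h : G)) :=
      hc.comp (Continuous.prodMk_left (h : G))
    refine hcont.continuousAt.eventually ?_
    change U ∈ 𝓝 (p <• (h : G))
    rw [mem_isotropyGroup.1 h.2]; exact hU
  have h2 := eventually_isotropyGroup_subset hp hc (p := p)
    (O := ⋃ h : isotropyGroup G p, (fun x => (h : G)⁻¹ * x) ⁻¹' interior W)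
    (isOpen_iUnion fun h => isOpen_interior.preimage (continuous_const_mul _))
    (fun h hh => Set.mem_iUnion.2 ⟨⟨h, hh⟩, by simpa using mem_interior_iff_mem_nhds.2 hW⟩)
  filter_upwards [eventually_all.2 h1, h2] with s hsU hsO hs g hg
  obtain ⟨h, hh⟩ := Set.mem_iUnion.1 (hsO hg)
  -- Write `g = h u` with `u ∈ W`. Then `f` vanishes at `s · h` and at `(s · h) · u = s`, so
  -- injectivity on the orbit piece through `s · h` gives `u = 1`.
  have key : (h : G)⁻¹ * g = 1 := by
    refine hinj _ (hsU h) _ (interior_subset hh) 1 (mem_of_mem_nhds hW) ?_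
    rw [← op_smul_mul, mul_inv_cancel_left, mem_isotropyGroup.1 hg]
    simp [hs, hf _ h.2 s hs]
  rw [inv_mul_eq_one] at key
  exact key ▸ h.2

end Topological

/-! ### Differentials of translations along the zero set. -/

section Isotropy

variable {E F : Type*} [NormedAddCommGroup E] [NormedSpace ℝ E]
  [NormedAddCommGroup F] [NormedSpace ℝ F]
  {G : Type*} [TopologicalSpace G] [ChartedSpace E G] [Group G]
  {P : Type*} [TopologicalSpace P] [ChartedSpace F P] [MulAction Gᵐᵒᵖ P]

theorem exists_map_with_mfderiv [IsManifold 𝓘(ℝ, F) ∞ P] (p : P)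
    (A : TangentSpace 𝓘(ℝ, F) p →L[ℝ] E) :
    ∃ f : P → E, ContMDiffAt 𝓘(ℝ, F) 𝓘(ℝ, E) ∞ f p ∧ f p = 0 ∧
      ∀ v, mfderiv 𝓘(ℝ, F) 𝓘(ℝ, E) f p v = A v := by
  obtain ⟨c, e, x₀, rfl, hc⟩ := exists_isLocalParam (F := F) p
  let A' : F →L[ℝ] E := A.comp (mfderiv 𝓘(ℝ, F) 𝓘(ℝ, F) c x₀)
  have hA : ContDiff ℝ ∞ (fun x => A' (x - x₀)) := by fun_prop
  refine ⟨fun q => A' (e q - x₀), ?_, ?_, fun v => ?_⟩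
  · exact ContMDiffAt.comp (I' := 𝓘(ℝ, F)) (c x₀) (g := fun x => A' (x - x₀))
      hA.contMDiff.contMDiffAt hc.contMDiffAt_inv
  · simp [hc.inv_apply]
  · have h1 : HasFDerivAt (fun x => A' (x - x₀)) A' (e (c x₀)) :=
      A'.hasFDerivAt.comp _ ((hasFDerivAt_id _).sub_const x₀)
    have h2 := (h1.hasMFDerivAt.comp (c x₀) hc.mdifferentiableAt_inv.hasMFDerivAt).mfderiv
    refine (congrArg (fun L => L v) h2).trans ?_
    exact congrArg A (hc.mfderiv_mfderiv_inv v)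

/-- If `h` fixes the zero set of `f` near `p`, then its differential at `p` is the identity on the
tangent space of this zero set. -/
theorem mfderiv_translation_eq_self [FiniteDimensional ℝ E] [FiniteDimensional ℝ F]
    [IsManifold 𝓘(ℝ, F) ∞ P] (hs : IsSmoothRightAction (E := E) (F := F) G P)
    {f : P → E} {p : P} (hf : ContMDiffAt 𝓘(ℝ, F) 𝓘(ℝ, E) ∞ f p) (hfp : f p = 0)
    (hsurj : Function.Surjective (mfderiv 𝓘(ℝ, F) 𝓘(ℝ, E) f p)) {h : G}
    (hh : ∀ᶠ s in 𝓝 p, f s = 0 → s <• h = s) (v : TangentSpace 𝓘(ℝ, F) p)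
    (hv : mfderiv 𝓘(ℝ, F) 𝓘(ℝ, E) f p v = 0) :
    (mfderiv 𝓘(ℝ, F) 𝓘(ℝ, F) (fun q : P => q <• h) p v : F) = v := by
  obtain ⟨c, e, x₀, rfl, hc⟩ := exists_isLocalParam (F := F) p
  have : CompleteSpace F := FiniteDimensional.complete ℝ F
  have hfc : ContDiffAt ℝ ∞ (f ∘ c) x₀ := by
    rw [← contMDiffAt_iff_contDiffAt]
    exact hf.comp x₀ hc.contMDiffAt
  have hstr := hfc.hasStrictFDerivAt (by simp)
  have hder : ∀ w : F, fderiv ℝ (f ∘ c) x₀ w =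
      mfderiv 𝓘(ℝ, F) 𝓘(ℝ, E) f (c x₀) (mfderiv 𝓘(ℝ, F) 𝓘(ℝ, F) c x₀ w) := by
    intro w
    rw [← mfderiv_eq_fderiv]
    exact mfderiv_comp_apply x₀ (hf.mdifferentiableAt (by simp)) hc.mdifferentiableAt w
  have hrange : (fderiv ℝ (f ∘ c) x₀).range = ⊤ := by
    refine LinearMap.range_eq_top.2 fun ξ => ?_
    obtain ⟨u, hu⟩ := hsurj ξ
    refine ⟨mfderiv 𝓘(ℝ, F) 𝓘(ℝ, F) e (c x₀) u, (hder _).trans ?_⟩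
    rw [← hu]
    exact congrArg (mfderiv 𝓘(ℝ, F) 𝓘(ℝ, E) f (c x₀)) (hc.mfderiv_mfderiv_inv u)
  -- `ψ` parametrizes the zero set of `f ∘ c` near `x₀` by the kernel of its differential.
  -- Translation by `h` fixes `c ∘ ψ` near `0`, and the chain rule at `0` gives the claim.
  set ψ := hstr.implicitFunction (f ∘ c) _ hrange 0 with hψ
  have hfx : (f ∘ c) x₀ = 0 := hfp
  have hψ0 : ψ 0 = x₀ := by
    rw [hψ, ← hfx]; exact hstr.implicitFunction_apply_image hrange
  have hψd : HasFDerivAt ψ (fderiv ℝ (f ∘ c) x₀).ker.subtypeL 0 := by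
    have := (hstr.to_implicitFunction hrange).hasFDerivAt
    rwa [hfx] at this
  have hzero : ∀ᶠ w in 𝓝 (0 : (fderiv ℝ (f ∘ c) x₀).ker), f (c (ψ w)) = 0 := by
    have h1 := hstr.map_implicitFunction_eq hrange
    rw [hfx] at h1
    exact (Continuous.prodMk_right (0 : E)).continuousAt.eventually h1
  have hσ : Tendsto (c ∘ ψ) (𝓝 0) (𝓝 (c x₀)) := by
    have h1 : Tendsto ψ (𝓝 0) (𝓝 x₀) := by
      have := hψd.continuousAt; rwa [ContinuousAt, hψ0] at this
    exact hc.contMDiffAt.continuousAt.tendsto.comp h1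
  have heq : (fun q : P => q <• h) ∘ (c ∘ ψ) =ᶠ[𝓝 0] c ∘ ψ := by
    filter_upwards [hzero, hσ.eventually hh] with w hw hw' using hw' hw
  have hcψ : MDifferentiableAt 𝓘(ℝ, (fderiv ℝ (f ∘ c) x₀).ker) 𝓘(ℝ, F) (c ∘ ψ) 0 :=
    MDifferentiableAt.comp 0 (by rw [hψ0]; exact hc.mdifferentiableAt)
      hψd.differentiableAt.mdifferentiableAt
  let w : (fderiv ℝ (f ∘ c) x₀).ker := ⟨mfderiv 𝓘(ℝ, F) 𝓘(ℝ, F) e (c x₀) v, by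
    exact (hder _).trans ((congrArg (mfderiv 𝓘(ℝ, F) 𝓘(ℝ, E) f (c x₀))
      (hc.mfderiv_mfderiv_inv v)).trans hv)⟩
  have hw : (mfderiv 𝓘(ℝ, (fderiv ℝ (f ∘ c) x₀).ker) 𝓘(ℝ, F) (c ∘ ψ) 0 w : F) = v := by
    refine (mfderiv_comp_apply_of_eq (g := c) (f := ψ) 0 hc.mdifferentiableAt
      hψd.differentiableAt.mdifferentiableAt hψ0 w).trans ?_
    rw [hψd.hasMFDerivAt.mfderiv]
    exact hc.mfderiv_mfderiv_inv v
  have h3 := mfderiv_comp_apply_of_eq (g := fun q : P => q <• h) (f := c ∘ ψ) 0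
    ((hs.contMDiff_translation h).mdifferentiable (by simp) (c x₀)) hcψ
    (congrArg c hψ0) w
  rw [heq.mfderiv_eq] at h3
  have h4 : (mfderiv 𝓘(ℝ, F) 𝓘(ℝ, F) (fun q : P => q <• h) (c x₀) v : F) =
      mfderiv 𝓘(ℝ, F) 𝓘(ℝ, F) (fun q : P => q <• h) (c x₀)
        (mfderiv 𝓘(ℝ, (fderiv ℝ (f ∘ c) x₀).ker) 𝓘(ℝ, F) (c ∘ ψ) 0 w : F) :=
    congrArg (mfderiv 𝓘(ℝ, F) 𝓘(ℝ, F) (fun q : P => q <• h) (c x₀)) hw.symm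
  exact h4.trans (h3.symm.trans hw)

end Isotropy

/-! ### Equivariant maps transverse to an orbit -/

/-- The adjoint representation: the differential of `x ↦ g x g⁻¹` at the identity. -/
def adjointRep {E : Type*} [NormedAddCommGroup E] [NormedSpace ℝ E]
    {G : Type*} [TopologicalSpace G] [ChartedSpace E G] [Group G] (g : G) : E →L[ℝ] E :=
  mfderiv 𝓘(ℝ, E) 𝓘(ℝ, E) (fun x : G => g * x * g⁻¹) 1

theorem adjointRep_one {E : Type*} [NormedAddCommGroup E] [NormedSpace ℝ E]
    {G : Type*} [TopologicalSpace G] [ChartedSpace E G] [Group G] (ξ : E) :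
    adjointRep (1 : G) ξ = ξ := by
  have h : (fun x : G => 1 * x * 1⁻¹) = id := by funext x; simp
  rw [adjointRep, h, mfderiv_id]; rfl

theorem average_apply_eq {V W ι : Type*} [NormedAddCommGroup V] [NormedSpace ℝ V]
    [NormedAddCommGroup W] [NormedSpace ℝ W] [Fintype ι] [Nonempty ι] {L : ι → V →L[ℝ] W} {v : V}
    {w : W} (h : ∀ i, L i v = w) : ((Fintype.card ι : ℝ)⁻¹ • ∑ i, L i) v = w := by
  simp [h, ← Nat.cast_smul_eq_nsmul ℝ, smul_smul]

theorem hasMFDerivAt_finsetSum {F W ι P : Type*} [NormedAddCommGroup F] [NormedSpace ℝ F]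
    [NormedAddCommGroup W] [NormedSpace ℝ W] [TopologicalSpace P] [ChartedSpace F P] {p : P}
    {t : Finset ι} {f : ι → P → W} {f' : ι → F →L[ℝ] W}
    (hf : ∀ i ∈ t, HasMFDerivAt 𝓘(ℝ, F) 𝓘(ℝ, W) (f i) p (f' i)) :
    HasMFDerivAt 𝓘(ℝ, F) 𝓘(ℝ, W) (∑ i ∈ t, f i) p (∑ i ∈ t, f' i : F →L[ℝ] W) := by
  classical
  induction t using Finset.induction_on with
  | empty => simpa using! hasMFDerivAt_const (0 : W) p
  | insert i s hi IH =>
    rw [Finset.sum_insert hi, Finset.sum_insert hi]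
    exact (hf i (Finset.mem_insert_self i s)).add
      (IH fun j hj => hf j (Finset.mem_insert_of_mem hj))

section Average

variable {E F : Type*} [NormedAddCommGroup E] [NormedSpace ℝ E]
  [NormedAddCommGroup F] [NormedSpace ℝ F]
  {G : Type*} [TopologicalSpace G] [ChartedSpace E G] [Group G] [LieGroup 𝓘(ℝ, E) ∞ G]
  {P : Type*} [TopologicalSpace P] [ChartedSpace F P] [MulAction Gᵐᵒᵖ P]

variable (E) in
theorem mdifferentiable_conj (g : G) :
    MDifferentiable 𝓘(ℝ, E) 𝓘(ℝ, E) (fun x : G => g * x * g⁻¹) := by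
  have h : ContMDiff 𝓘(ℝ, E) 𝓘(ℝ, E) ∞ (fun x : G => g * x * g⁻¹) :=
    (contMDiff_const.mul contMDiff_id).mul contMDiff_const
  exact h.mdifferentiable (by simp)

theorem adjointRep_mul (g h : G) (ξ : E) :
    adjointRep (g * h) ξ = adjointRep g (adjointRep h ξ) := by
  have h1 := mfderiv_comp_apply_of_eq (f := fun x : G => h * x * h⁻¹)
    (g := fun x : G => g * x * g⁻¹) (1 : G) (mdifferentiable_conj E g 1)
    (mdifferentiable_conj E h 1) (by simp) (ξ : GroupLieAlgebra 𝓘(ℝ, E) G)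
  refine Eq.trans ?_ h1
  have h2 : (fun x : G => g * x * g⁻¹) ∘ (fun x : G => h * x * h⁻¹) =
      fun x => (g * h) * x * (g * h)⁻¹ := by
    funext x; simp [mul_assoc]
  rw [h2]; rfl

/-- Differentiate `p · (x h) = p · (h⁻¹ x h)`, valid because `h` fixes `p`, at `x = 1`. -/
theorem mfderiv_translation_fundamentalField (hs : IsSmoothRightAction (E := E) (F := F) G P)
    {p : P} {h : G} (hh : p <• h = p) (ξ : GroupLieAlgebra 𝓘(ℝ, E) G) :
    (mfderiv 𝓘(ℝ, F) 𝓘(ℝ, F) (fun q : P => q <• h) p (fundamentalField F ξ p) : F) =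
      fundamentalField F (G := G) (adjointRep (E := E) h⁻¹ ξ) p := by
  have h1 := mfderiv_comp_apply_of_eq (f := fun g : G => p <• g) (g := fun q : P => q <• h) 1
    ((hs.contMDiff_translation h).mdifferentiable (by simp) p)
    ((hs.contMDiff_orbit p).mdifferentiable (by simp) 1) (by simp) ξ
  have h2 := mfderiv_comp_apply_of_eq (f := fun x : G => h⁻¹ * x * h⁻¹⁻¹)
    (g := fun g : G => p <• g) 1 ((hs.contMDiff_orbit p).mdifferentiable (by simp) 1)
    (mdifferentiable_conj E h⁻¹ 1) (by simp) ξ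
  have h3 : (fun q : P => q <• h) ∘ (fun g : G => p <• g) =
      (fun g : G => p <• g) ∘ fun x : G => h⁻¹ * x * h⁻¹⁻¹ := by
    have hh' : p <• h⁻¹ = p := (isotropyGroup G p).inv_mem hh
    funext x
    simp only [Function.comp_apply, inv_inv]
    rw [op_smul_mul, op_smul_mul, hh']
  rw [h3] at h1
  exact h1.symm.trans h2

/-- The function is the mean over the isotropy group of `q ↦ Ad(h) f₀(q · h)`. On fundamental
vectors at `p` the differential of each term is already the identity, since `dR_h` turns `ξ` into
`Ad(h⁻¹) ξ`; averaging preserves this. -/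
theorem exists_equivariant_map [IsManifold 𝓘(ℝ, F) ∞ P]
    (hs : IsSmoothRightAction (E := E) (F := F) G P) (p : P) [Finite (isotropyGroup G p)]
    {f₀ : P → E} (hf₀ : ContMDiffAt 𝓘(ℝ, F) 𝓘(ℝ, E) ∞ f₀ p) (hf₀p : f₀ p = 0)
    (hB : ∀ ξ : GroupLieAlgebra 𝓘(ℝ, E) G,
      mfderiv 𝓘(ℝ, F) 𝓘(ℝ, E) f₀ p (fundamentalField F ξ p) = ξ) :
    ∃ f : P → E, ContMDiffAt 𝓘(ℝ, F) 𝓘(ℝ, E) ∞ f p ∧ f p = 0 ∧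
      (∀ ξ : GroupLieAlgebra 𝓘(ℝ, E) G,
        mfderiv 𝓘(ℝ, F) 𝓘(ℝ, E) f p (fundamentalField F ξ p) = ξ) ∧
      ∀ h ∈ isotropyGroup G p, ∀ q, f q = 0 → f (q <• h) = 0 := by
  have := Fintype.ofFinite (isotropyGroup G p)
  let T : isotropyGroup G p → P → E := fun h q => adjointRep (h : G) (f₀ (q <• (h : G)))
  let N : ℝ := Fintype.card (isotropyGroup G p)
  have hN : N ≠ 0 := Nat.cast_ne_zero.2 Fintype.card_ne_zero
  have hT : ∀ h, ContMDiffAt 𝓘(ℝ, F) 𝓘(ℝ, E) ∞ (T h) p := by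
    intro h
    have h1 : ContMDiffAt 𝓘(ℝ, F) 𝓘(ℝ, E) ∞ (fun q => f₀ (q <• (h : G))) p :=
      ContMDiffAt.comp p (g := f₀) (by rw [mem_isotropyGroup.1 h.2]; exact hf₀)
        (hs.contMDiff_translation (h : G)).contMDiffAt
    exact ContMDiffAt.comp (I' := 𝓘(ℝ, E)) p (g := adjointRep (E := E) (h : G))
      (adjointRep (E := E) (h : G)).contDiff.contMDiff.contMDiffAt h1
  have hTd : ∀ h (ξ : GroupLieAlgebra 𝓘(ℝ, E) G),
      mfderiv 𝓘(ℝ, F) 𝓘(ℝ, E) (T h) p (fundamentalField F ξ p) = ξ := by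
    intro h ξ
    have htr := (hs.contMDiff_translation (h : G)).mdifferentiable (by simp) p
    have h1 := mfderiv_comp_apply_of_eq (f := fun q : P => q <• (h : G)) (g := f₀) p
      (hf₀.mdifferentiableAt (by simp)) htr (mem_isotropyGroup.1 h.2) (fundamentalField F ξ p)
    have h2 : (mfderiv 𝓘(ℝ, F) 𝓘(ℝ, E) (f₀ ∘ fun q : P => q <• (h : G)) p
        (fundamentalField F ξ p) : E) = adjointRep (E := E) (h : G)⁻¹ ξ := by
      refine h1.trans (Eq.trans ?_ (hB (adjointRep (E := E) (h : G)⁻¹ ξ)))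
      exact congrArg (mfderiv 𝓘(ℝ, F) 𝓘(ℝ, E) f₀ p)
        (mfderiv_translation_fundamentalField hs (mem_isotropyGroup.1 h.2) ξ)
    have h3 := mfderiv_comp_apply (f := f₀ ∘ fun q : P => q <• (h : G))
      (g := adjointRep (E := E) (h : G)) (I' := 𝓘(ℝ, E)) p
      (adjointRep (E := E) (h : G)).differentiableAt.mdifferentiableAt
      (MDifferentiableAt.comp p (by rw [mem_isotropyGroup.1 h.2]
                                    exact hf₀.mdifferentiableAt (by simp)) htr)
      (fundamentalField F ξ p)
    rw [(adjointRep (E := E) (h : G)).hasFDerivAt.hasMFDerivAt.mfderiv] at h3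
    refine h3.trans ((congrArg (adjointRep (E := E) (h : G)) h2).trans ?_)
    refine (adjointRep_mul (E := E) (h : G) (h : G)⁻¹ ξ).symm.trans ?_
    rw [mul_inv_cancel]
    exact adjointRep_one (E := E) ξ
  refine ⟨N⁻¹ • ∑ h, T h, ?_, ?_, fun ξ => ?_, ?_⟩
  · refine ContMDiffAt.comp (I' := 𝓘(ℝ, E)) p (g := fun x : E => N⁻¹ • x)
      (contDiff_const_smul _).contMDiff.contMDiffAt ?_
    have := ContMDiffAt.sum (t := Finset.univ) (f := T) (x₀ := p) (fun h _ => hT h)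
    convert! this using 1
    ext q
    simp
  · have : ∀ h, T h p = 0 := by
      intro h
      simp only [T]
      rw [mem_isotropyGroup.1 h.2, hf₀p, map_zero]
    simp [this]
  · let L : isotropyGroup G p → F →L[ℝ] E := fun h => mfderiv 𝓘(ℝ, F) 𝓘(ℝ, E) (T h) p
    have hL : ∀ h ∈ Finset.univ, HasMFDerivAt 𝓘(ℝ, F) 𝓘(ℝ, E) (T h) p (L h) := fun h _ =>
      ((hT h).mdifferentiableAt (by simp)).hasMFDerivAt
    have h1 := ((hasMFDerivAt_finsetSum hL).const_smul N⁻¹).mfderiv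
    refine (congrArg (fun L => L (fundamentalField F ξ p)) h1).trans ?_
    exact average_apply_eq (V := F) (W := E) (L := L) fun h => hTd h ξ
  · intro k hk q hq
    have hq' : ∑ h, T h q = 0 := by
      have : N⁻¹ • (∑ h, T h q) = 0 := by simpa using hq
      exact (smul_eq_zero.1 this).resolve_left (inv_ne_zero hN)
    -- Reindexing by `h ↦ k h` gives `f(q · k) = Ad(k⁻¹) f(q)`. This is purely algebraic, so it
    -- holds at every `q`, even where `f₀` is not smooth.
    have h1 : ∑ h, T h (q <• k) = adjointRep k⁻¹ (∑ h, T h q) := by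
      rw [map_sum]
      refine Fintype.sum_equiv (Equiv.mulLeft ⟨k, hk⟩) _ _ fun h => ?_
      simp only [T, Equiv.coe_mulLeft, Subgroup.coe_mul]
      rw [← adjointRep_mul, inv_mul_cancel_left, op_smul_mul]
    simp [h1, hq']

end Average

/-! ### The Lie derivative along a fundamental vector field -/

/-- Points such as `p · h` and `p` are equal only propositionally, so tangent vectors at them are
compared in the common model space `F`. -/
theorem oneForm_congr {F : Type*} [NormedAddCommGroup F] [NormedSpace ℝ F]
    {P : Type*} [TopologicalSpace P] [ChartedSpace F P]
    {W : Type*} [NormedAddCommGroup W] [NormedSpace ℝ W]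
    (θ : ∀ p : P, TangentSpace 𝓘(ℝ, F) p →L[ℝ] W) {p q : P} (hpq : p = q)
    {v : TangentSpace 𝓘(ℝ, F) p} {w : TangentSpace 𝓘(ℝ, F) q} (hvw : (v : F) = w) :
    θ p v = θ q w := by
  subst hpq
  exact congrArg (θ p) hvw

theorem mlieBracket_eq_lieBracket {F : Type*} [NormedAddCommGroup F] [NormedSpace ℝ F]
    {V W : ∀ x : F, TangentSpace 𝓘(ℝ, F) x} :
    VectorField.mlieBracket 𝓘(ℝ, F) V W = VectorField.lieBracket ℝ V W := by
  rw [← VectorField.mlieBracketWithin_univ, VectorField.mlieBracketWithin_eq_lieBracketWithin]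
  exact VectorField.lieBracketWithin_univ (E := F)

section VectorField

variable {F : Type*} [NormedAddCommGroup F] [NormedSpace ℝ F] [CompleteSpace F]
  {P : Type*} [TopologicalSpace P] [ChartedSpace F P] [IsManifold 𝓘(ℝ, F) ∞ P]
  {c : F → P} {e : P → F} {x₀ : F}

/-- The Lie bracket of two vector fields, computed in a parametrization. -/
theorem IsLocalParam.mlieBracket_eq (hc : IsLocalParam c e x₀) {X Z : F → F}
    (hX : ContDiffAt ℝ ∞ X x₀) (hZ : ContDiffAt ℝ ∞ Z x₀)
    {X' Z' : ∀ q : P, TangentSpace 𝓘(ℝ, F) q}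
    (hX' : ∀ᶠ x in 𝓝 x₀, X' (c x) = mfderiv 𝓘(ℝ, F) 𝓘(ℝ, F) c x (X x))
    (hZ' : ∀ᶠ x in 𝓝 x₀, Z' (c x) = mfderiv 𝓘(ℝ, F) 𝓘(ℝ, F) c x (Z x)) :
    VectorField.mlieBracket 𝓘(ℝ, F) X' Z' (c x₀) =
      mfderiv 𝓘(ℝ, F) 𝓘(ℝ, F) c x₀ (VectorField.lieBracket (E := F) ℝ X Z x₀) := by
  have h2 : (2 : ℕ∞ω) ≤ ∞ := WithTop.coe_le_coe.2 le_top
  have : IsManifold 𝓘(ℝ, F) (minSmoothness ℝ 2) P := IsManifold.of_le (n := ∞) (by simpa using h2)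
  have hpull : ∀ {X : F → F} {X' : ∀ q : P, TangentSpace 𝓘(ℝ, F) q},
      (∀ᶠ x in 𝓝 x₀, X' (c x) = mfderiv 𝓘(ℝ, F) 𝓘(ℝ, F) c x (X x)) →
      (VectorField.mpullback 𝓘(ℝ, F) 𝓘(ℝ, F) c X' : F → F) =ᶠ[𝓝 x₀] X := by
    intro X X' h
    filter_upwards [h, hc.eventually] with x hx hcx
    rw [VectorField.mpullback_apply, hx]
    exact hcx.isInvertible_mfderiv.inverse_apply_eq.2 rfl
  have h1 := VectorField.mpullback_mlieBracket (n := ∞)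
    ((hc.contMDiffAt_vectorField hX hX').mdifferentiableAt (by simp))
    ((hc.contMDiffAt_vectorField hZ hZ').mdifferentiableAt (by simp)) hc.contMDiffAt
    (by simpa using h2)
  rw [VectorField.mpullback_apply] at h1
  have h3 : VectorField.mlieBracket 𝓘(ℝ, F) (VectorField.mpullback 𝓘(ℝ, F) 𝓘(ℝ, F) c X')
      (VectorField.mpullback 𝓘(ℝ, F) 𝓘(ℝ, F) c Z') x₀ = VectorField.lieBracket (E := F) ℝ X Z x₀ := by
    refine (Filter.EventuallyEq.mlieBracket_vectorField_eq (hpull hX') (hpull hZ')).trans ?_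
    exact congrFun mlieBracket_eq_lieBracket x₀
  exact (hc.isInvertible_mfderiv.inverse_apply_eq.1 h1).trans
    (congrArg (mfderiv 𝓘(ℝ, F) 𝓘(ℝ, F) c x₀) h3)

end VectorField

/-- The right action in local coordinates. -/
def localAction {E F G P : Type*} [Group G] [MulAction Gᵐᵒᵖ P] (c : F → P) (e : P → F) (d : E → G)
    (z : F × E) : F := e (c z.1 <• d z.2)

theorem localAction_right {E F G P : Type*} [NormedAddCommGroup F] [NormedSpace ℝ F] [Group G]
    [TopologicalSpace P] [ChartedSpace F P] [MulAction Gᵐᵒᵖ P] {c : F → P} {e : P → F} {x₀ : F}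
    {d : E → G} {y₀ : E} (hc : IsLocalParam c e x₀) (hy₀ : d y₀ = 1) :
    localAction c e d (x₀, y₀) = x₀ := by
  simp [localAction, hy₀, hc.inv_apply]

section LieDerivative

variable {E F : Type*} [NormedAddCommGroup E] [NormedSpace ℝ E]
  [NormedAddCommGroup F] [NormedSpace ℝ F]
  {G : Type*} [TopologicalSpace G] [ChartedSpace E G] [Group G]
  {P : Type*} [TopologicalSpace P] [ChartedSpace F P] [MulAction Gᵐᵒᵖ P]
  {c : F → P} {e : P → F} {x₀ : F} {d : E → G} {d' : G → E} {y₀ : E}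

theorem contDiffAt_localAction (hs : IsSmoothRightAction (E := E) (F := F) G P)
    (hc : IsLocalParam c e x₀) (hd : IsLocalParam d d' y₀) (hy₀ : d y₀ = 1) :
    ContDiffAt ℝ ∞ (localAction c e d) (x₀, y₀) := by
  rw [← contMDiffAt_iff_contDiffAt]
  refine ContMDiffAt.comp (x₀, y₀) (g := e) ?_ (hs.contMDiffAt_param hc.contMDiffAt hd.contMDiffAt)
  simpa [hy₀] using hc.contMDiffAt_inv

theorem eventually_localAction (hs : IsSmoothRightAction (E := E) (F := F) G P)
    (hc : IsLocalParam c e x₀) (hd : IsLocalParam d d' y₀) (hy₀ : d y₀ = 1) :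
    ∀ᶠ z in 𝓝 (x₀, y₀), c (localAction c e d z) = c z.1 <• d z.2 := by
  have h := (hs.contMDiffAt_param hc.contMDiffAt hd.contMDiffAt).continuousAt
  refine h.eventually (p := fun q => c (e q) = q) ?_
  simpa [hy₀] using hc.right_inv

theorem eventually_contDiffAt_localAction (hs : IsSmoothRightAction (E := E) (F := F) G P)
    (hc : IsLocalParam c e x₀) (hd : IsLocalParam d d' y₀) (hy₀ : d y₀ = 1) :
    ∀ᶠ z in 𝓝 (x₀, y₀), DifferentiableAt ℝ (localAction c e d) z := by
  filter_upwards [((contDiffAt_localAction hs hc hd hy₀).of_le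
    (m := 1) (by simp)).eventually (by simp)] with z hz using hz.differentiableAt (by simp)

/-- The differential of a translation in local coordinates. -/
theorem eventually_mfderiv_translation (hs : IsSmoothRightAction (E := E) (F := F) G P)
    (hc : IsLocalParam c e x₀) (hd : IsLocalParam d d' y₀) (hy₀ : d y₀ = 1) (v : F) :
    ∀ᶠ y in 𝓝 y₀,
      (mfderiv 𝓘(ℝ, F) 𝓘(ℝ, F) (fun q : P => q <• d y) (c x₀)
        (mfderiv 𝓘(ℝ, F) 𝓘(ℝ, F) c x₀ v) : F) =
      mfderiv 𝓘(ℝ, F) 𝓘(ℝ, F) c (localAction c e d (x₀, y))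
        (fderiv ℝ (localAction c e d) (x₀, y) (v, 0) : F) := by
  have hcont : Tendsto (fun y : E => (x₀, y)) (𝓝 y₀) (𝓝 (x₀, y₀)) :=
    (Continuous.prodMk_right x₀).continuousAt
  have hm : Tendsto (fun y : E => localAction c e d (x₀, y)) (𝓝 y₀) (𝓝 x₀) := by
    have := (contDiffAt_localAction hs hc hd hy₀).continuousAt
    rw [ContinuousAt, localAction_right hc hy₀] at this
    exact this.comp hcont
  filter_upwards [hcont.eventually (eventually_localAction hs hc hd hy₀).eventually_nhds,
    hcont.eventually (eventually_contDiffAt_localAction hs hc hd hy₀),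
    hm.eventually hc.eventually] with y h1 h2 h3
  have hpair : HasFDerivAt (fun x : F => (x, y)) (ContinuousLinearMap.inl ℝ F E) x₀ :=
    hasFDerivAt_prodMk_left x₀ y
  have h4 : HasFDerivAt (fun x => localAction c e d (x, y)) _ x₀ :=
    HasFDerivAt.comp (g := localAction c e d) (f := fun x => (x, y)) x₀ h2.hasFDerivAt hpair
  have h5 : (fun q : P => q <• d y) ∘ c =ᶠ[𝓝 x₀] c ∘ fun x => localAction c e d (x, y) := by
    filter_upwards [hpair.continuousAt.eventually h1] with x hx using hx.symm
  have h6 := mfderiv_comp_apply (g := fun q : P => q <• d y) (f := c) x₀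
    ((hs.contMDiff_translation (d y)).mdifferentiable (by simp) _) hc.mdifferentiableAt v
  have h7 := mfderiv_comp_apply (g := c) (f := fun x => localAction c e d (x, y)) x₀
    h3.mdifferentiableAt h4.differentiableAt.mdifferentiableAt v
  rw [h4.hasMFDerivAt.mfderiv] at h7
  refine h6.symm.trans (Eq.trans ?_ h7)
  rw [h5.mfderiv_eq]
  rfl

/-- The fundamental vector fields in local coordinates. -/
theorem eventually_fundamentalField (hs : IsSmoothRightAction (E := E) (F := F) G P)
    (hc : IsLocalParam c e x₀) (hd : IsLocalParam d d' y₀) (hy₀ : d y₀ = 1) (η : E) :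
    ∀ᶠ x in 𝓝 x₀,
      fundamentalField F (G := G) (mfderiv 𝓘(ℝ, E) 𝓘(ℝ, E) d y₀ η) (c x) =
      mfderiv 𝓘(ℝ, F) 𝓘(ℝ, F) c x (fderiv ℝ (localAction c e d) (x, y₀) (0, η) : F) := by
  have hcont : Tendsto (fun x : F => (x, y₀)) (𝓝 x₀) (𝓝 (x₀, y₀)) :=
    (Continuous.prodMk_left y₀).continuousAt
  filter_upwards [hcont.eventually (eventually_localAction hs hc hd hy₀).eventually_nhds,
    hcont.eventually (eventually_contDiffAt_localAction hs hc hd hy₀),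
    hc.eventually] with x h1 h2 h3
  have hpair : HasFDerivAt (fun y : E => (x, y)) (ContinuousLinearMap.inr ℝ F E) y₀ :=
    hasFDerivAt_prodMk_right x y₀
  have h4 : HasFDerivAt (fun y => localAction c e d (x, y)) _ y₀ :=
    HasFDerivAt.comp (g := localAction c e d) (f := fun y => (x, y)) y₀ h2.hasFDerivAt hpair
  have h5 : (fun g : G => c x <• g) ∘ d =ᶠ[𝓝 y₀] c ∘ fun y => localAction c e d (x, y) := by
    filter_upwards [hpair.continuousAt.eventually h1] with y hy using hy.symm
  have h6 := mfderiv_comp_apply_of_eq (g := fun g : G => c x <• g) (f := d) y₀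
    ((hs.contMDiff_orbit (c x)).mdifferentiable (by simp) 1) hd.mdifferentiableAt hy₀ η
  have h7 := mfderiv_comp_apply_of_eq (g := c) (f := fun y => localAction c e d (x, y)) y₀
    h3.mdifferentiableAt h4.differentiableAt.mdifferentiableAt (localAction_right h3 hy₀) η
  rw [h4.hasMFDerivAt.mfderiv] at h7
  refine h6.symm.trans (Eq.trans ?_ h7)
  rw [h5.mfderiv_eq]
  rfl

theorem fderiv_localAction_inl (hs : IsSmoothRightAction (E := E) (F := F) G P)
    (hc : IsLocalParam c e x₀) (hd : IsLocalParam d d' y₀) (hy₀ : d y₀ = 1) (v : F) :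
    fderiv ℝ (localAction c e d) (x₀, y₀) (v, 0) = v := by
  have h2 := (contDiffAt_localAction hs hc hd hy₀).differentiableAt (by simp)
  have h4 : HasFDerivAt (fun x => localAction c e d (x, y₀)) _ x₀ :=
    HasFDerivAt.comp (g := localAction c e d) (f := fun x => (x, y₀)) x₀ h2.hasFDerivAt
      (hasFDerivAt_prodMk_left x₀ y₀)
  have h5 : (fun x => localAction c e d (x, y₀)) =ᶠ[𝓝 x₀] id := by
    filter_upwards [hc.eventually] with x hx using localAction_right hx hy₀
  have h6 := (h4.congr_of_eventuallyEq h5.symm).unique (hasFDerivAt_id x₀)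
  simpa using congrArg (fun L : F →L[ℝ] F => L v) h6

end LieDerivative

/-! ### Pullbacks of one-forms under translations. -/

section Pullback

variable {F : Type*} [NormedAddCommGroup F] [NormedSpace ℝ F] {G : Type*} [Group G]
  {P : Type*} [TopologicalSpace P] [ChartedSpace F P] [MulAction Gᵐᵒᵖ P]
  {W : Type*} [NormedAddCommGroup W] [NormedSpace ℝ W]

/-- The value at `w ∈ T_pP` of the pullback of a `1`-form under the translation by `g`. -/
def pullbackTranslation (θ : ∀ p : P, TangentSpace 𝓘(ℝ, F) p →L[ℝ] W) (p : P)
    (w : TangentSpace 𝓘(ℝ, F) p) (g : G) : W :=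
  θ (p <• g) (mfderiv 𝓘(ℝ, F) 𝓘(ℝ, F) (fun q : P => q <• g) p w)

theorem pullbackTranslation_one (θ : ∀ p : P, TangentSpace 𝓘(ℝ, F) p →L[ℝ] W) (p : P) (w : TangentSpace 𝓘(ℝ, F) p) :
    pullbackTranslation θ p w (1 : G) = θ p w := by
  refine oneForm_congr θ (by simp) ?_
  have h : (fun q : P => q <• (1 : G)) = id := by funext q; simp
  rw [h, mfderiv_id]; rfl

theorem pullbackTranslation_mul {E : Type*} [NormedAddCommGroup E] [NormedSpace ℝ E]
    [TopologicalSpace G] [ChartedSpace E G] (hs : IsSmoothRightAction (E := E) (F := F) G P)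
    (θ : ∀ p : P, TangentSpace 𝓘(ℝ, F) p →L[ℝ] W) (p : P) (w : TangentSpace 𝓘(ℝ, F) p) (g h : G) :
    pullbackTranslation θ p w (g * h) = pullbackTranslation θ (p <• g)
      (mfderiv 𝓘(ℝ, F) 𝓘(ℝ, F) (fun q : P => q <• g) p w) h := by
  refine oneForm_congr θ (op_smul_mul _ _ _) ?_
  have h1 := mfderiv_comp_apply (g := fun q : P => q <• h) (f := fun q : P => q <• g) p
    ((hs.contMDiff_translation h).mdifferentiable (by simp) _)
    ((hs.contMDiff_translation g).mdifferentiable (by simp) _) w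
  have h2 : (fun q : P => q <• (g * h)) = (fun q : P => q <• h) ∘ fun q : P => q <• g := by
    funext q; exact op_smul_mul _ _ _
  rw [h2]; exact h1

end Pullback

section Transport

variable {E F : Type*} [NormedAddCommGroup E] [NormedSpace ℝ E]
  [NormedAddCommGroup F] [NormedSpace ℝ F] [CompleteSpace F]
  {G : Type*} [TopologicalSpace G] [ChartedSpace E G] [Group G] [IsManifold 𝓘(ℝ, E) ∞ G]
  {P : Type*} [TopologicalSpace P] [ChartedSpace F P] [IsManifold 𝓘(ℝ, F) ∞ P] [MulAction Gᵐᵒᵖ P]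
  {W : Type*} [NormedAddCommGroup W] [NormedSpace ℝ W]

/-- The differential at the identity of the pullback of a `1`-form under translations is its Lie
derivative along the fundamental vector fields. -/
theorem exists_mfderiv_pullbackTranslation (hs : IsSmoothRightAction (E := E) (F := F) G P)
    {θ : ∀ p : P, TangentSpace 𝓘(ℝ, F) p →L[ℝ] W} (hθ : IsSmoothOneForm θ) (p : P)
    (w : TangentSpace 𝓘(ℝ, F) p) :
    ∃ Y : ∀ q : P, TangentSpace 𝓘(ℝ, F) q, Y p = w ∧
      ContMDiffAt 𝓘(ℝ, F) 𝓘(ℝ, F).tangent ∞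
        (fun q => (⟨q, Y q⟩ : TangentBundle 𝓘(ℝ, F) P)) p ∧
      MDifferentiableAt 𝓘(ℝ, E) 𝓘(ℝ, W) (pullbackTranslation (G := G) θ p w) 1 ∧
      ∀ ξ : GroupLieAlgebra 𝓘(ℝ, E) G,
        mfderiv 𝓘(ℝ, E) 𝓘(ℝ, W) (pullbackTranslation (G := G) θ p w) 1 ξ =
          lieDerivativeOneForm (fundamentalField F ξ) θ Y p := by
  obtain ⟨c, e, x₀, rfl, hc⟩ := exists_isLocalParam (F := F) p
  obtain ⟨d, d', y₀, hy₀, hd⟩ := exists_isLocalParam (F := E) (1 : G)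
  obtain ⟨v, rfl⟩ : ∃ v : F, mfderiv 𝓘(ℝ, F) 𝓘(ℝ, F) c x₀ v = w :=
    ⟨_, hc.mfderiv_mfderiv_inv w⟩
  set m := localAction c e d with hm
  have hmd : ContDiffAt ℝ ∞ m (x₀, y₀) := contDiffAt_localAction hs hc hd hy₀
  have hmd' : ContDiffAt ℝ ∞ (fderiv ℝ m) (x₀, y₀) := hmd.fderiv_right (by simp)
  have hm0 : m (x₀, y₀) = x₀ := localAction_right hc hy₀
  have hm1 : ∀ v, fderiv ℝ m (x₀, y₀) (v, 0) = v := fderiv_localAction_inl hs hc hd hy₀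
  -- The extension of `w` has constant coordinates `v`, so only the derivative of the fundamental
  -- field survives in the bracket.
  let Y : ∀ q : P, TangentSpace 𝓘(ℝ, F) q := fun q =>
    (mfderiv 𝓘(ℝ, F) 𝓘(ℝ, F) c (e q) v : F)
  have hY : ∀ᶠ x in 𝓝 x₀, Y (c x) = mfderiv 𝓘(ℝ, F) 𝓘(ℝ, F) c x v := by
    filter_upwards [hc.left_inv] with x hx
    change (mfderiv 𝓘(ℝ, F) 𝓘(ℝ, F) c (e (c x)) v : F) = _
    rw [hx]
  have hYs := hc.contMDiffAt_vectorField contDiffAt_const hY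
  let A : F × F → W := fun z => θ (c z.1) (mfderiv 𝓘(ℝ, F) 𝓘(ℝ, F) c z.1 z.2)
  have hA : HasFDerivAt A (fderiv ℝ A (x₀, v)) (x₀, v) :=
    ((hc.contDiffAt_oneForm hθ v).differentiableAt (by simp)).hasFDerivAt
  -- Coordinates of the translated point and of the translated vector as functions of the group
  -- parameter.
  let ζ : E → F × F := fun y => (m (x₀, y), fderiv ℝ m (x₀, y) (v, 0))
  have hinr : HasFDerivAt (fun y : E => (x₀, y)) (ContinuousLinearMap.inr ℝ F E) y₀ :=
    hasFDerivAt_prodMk_right x₀ y₀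
  let D2 := fderiv ℝ (fderiv ℝ m) (x₀, y₀)
  have hD2 : HasFDerivAt (fderiv ℝ m) D2 (x₀, y₀) :=
    (hmd'.differentiableAt (by simp)).hasFDerivAt
  have hζ : HasFDerivAt ζ _ y₀ :=
    (HasFDerivAt.comp (g := m) y₀ (hmd.differentiableAt (by simp)).hasFDerivAt hinr).prodMk
      ((HasFDerivAt.comp (g := fderiv ℝ m) y₀ hD2 hinr).clm_apply
        (hasFDerivAt_const ((v, 0) : F × E) y₀))
  have hζ0 : ζ y₀ = (x₀, v) := by simp only [ζ]; rw [hm0, hm1]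
  have hγ : pullbackTranslation θ (c x₀) (mfderiv 𝓘(ℝ, F) 𝓘(ℝ, F) c x₀ v) ∘ d =ᶠ[𝓝 y₀] A ∘ ζ := by
    filter_upwards [eventually_mfderiv_translation hs hc hd hy₀ v,
      hinr.continuousAt.eventually (eventually_localAction hs hc hd hy₀)] with y h1 h2
    exact oneForm_congr θ h2.symm h1
  have hAζ : HasFDerivAt (A ∘ ζ) _ y₀ := HasFDerivAt.comp y₀ (by rw [hζ0]; exact hA) hζ
  have hγd := hAζ.congr_of_eventuallyEq hγ
  have hγm : MDifferentiableAt 𝓘(ℝ, E) 𝓘(ℝ, W) (pullbackTranslation (G := G) θ (c x₀)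
      (mfderiv 𝓘(ℝ, F) 𝓘(ℝ, F) c x₀ v)) 1 := by
    rw [← hy₀]
    have h1 : MDifferentiableAt 𝓘(ℝ, E) 𝓘(ℝ, W) ((pullbackTranslation θ (c x₀)
        (mfderiv 𝓘(ℝ, F) 𝓘(ℝ, F) c x₀ v) ∘ d) ∘ d') (d y₀) :=
      MDifferentiableAt.comp (I' := 𝓘(ℝ, E)) (d y₀)
        (by rw [hd.inv_apply]; exact hγd.differentiableAt.mdifferentiableAt)
        hd.mdifferentiableAt_inv
    refine h1.congr_of_eventuallyEq ?_
    filter_upwards [hd.right_inv] with g hg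
    simp only [Function.comp_apply, hg]
  refine ⟨Y, hY.self_of_nhds, hYs, hγm, fun ξ => ?_⟩
  obtain ⟨η, rfl⟩ : ∃ η : E, (mfderiv 𝓘(ℝ, E) 𝓘(ℝ, E) d y₀ η : E) = ξ := by
    have := hd.mfderiv_mfderiv_inv (show E from ξ)
    exact ⟨_, this⟩
  have hleft : mfderiv 𝓘(ℝ, E) 𝓘(ℝ, W) (pullbackTranslation (G := G) θ (c x₀)
      (mfderiv 𝓘(ℝ, F) 𝓘(ℝ, F) c x₀ v)) 1 (mfderiv 𝓘(ℝ, E) 𝓘(ℝ, E) d y₀ η) =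
      fderiv ℝ A (x₀, v) (fderiv ℝ m (x₀, y₀) (0, η), D2 (0, η) (v, 0)) := by
    have h1 := mfderiv_comp_apply_of_eq y₀ hγm hd.mdifferentiableAt hy₀ η
    rw [hγd.hasMFDerivAt.mfderiv] at h1
    refine h1.symm.trans ?_
    change fderiv ℝ A (x₀, v) (fderiv ℝ m (x₀, y₀) (0, η),
      fderiv ℝ m (x₀, y₀) 0 + D2 (0, η) (v, 0)) = _
    rw [map_zero, zero_add]
  let X : F → F := fun x => fderiv ℝ m (x, y₀) (0, η)
  have hinl : HasFDerivAt (fun x : F => (x, y₀)) (ContinuousLinearMap.inl ℝ F E) x₀ :=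
    hasFDerivAt_prodMk_left x₀ y₀
  have hXs : ContDiffAt ℝ ∞ X x₀ := by
    refine ContDiffAt.clm_apply ?_ contDiffAt_const
    exact ContDiffAt.comp (g := fderiv ℝ m) x₀ hmd' (contDiffAt_id.prodMk contDiffAt_const)
  have hXd : ∀ u, fderiv ℝ X x₀ u = D2 (u, 0) (0, η) := by
    intro u
    have : HasFDerivAt X _ x₀ := (HasFDerivAt.comp (g := fderiv ℝ m) x₀ hD2 hinl).clm_apply
      (hasFDerivAt_const ((0, η) : F × E) x₀)
    rw [this.fderiv]
    simp
  have hbr := hc.mlieBracket_eq hXs contDiffAt_const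
    (eventually_fundamentalField hs hc hd hy₀ η) hY
  -- Symmetry of the second derivative is the heart of the formula: the variation of `dR_g v` in the
  -- direction `η` equals the derivative of the fundamental field along `v`, which is minus the
  -- bracket in coordinates.
  have hsymm : D2 (0, η) (v, 0) = D2 (v, 0) (0, η) :=
    by
    have h2 : (2 : ℕ∞ω) ≤ ∞ := WithTop.coe_le_coe.2 le_top
    exact (hmd.isSymmSndFDerivAt (by simpa using h2)).eq _ _
  -- `A` is linear in its second variable, so its partial derivative there is itself.
  have hAlin : ∀ u, fderiv ℝ A (x₀, v) (0, u) = A (x₀, u) := by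
    intro u
    let B : F →L[ℝ] W := (θ (c x₀)).comp (mfderiv 𝓘(ℝ, F) 𝓘(ℝ, F) c x₀)
    have h1 : HasFDerivAt (fun u => A (x₀, u)) _ v :=
      HasFDerivAt.comp (g := A) v hA (hasFDerivAt_prodMk_right x₀ v)
    have h2 : HasFDerivAt (fun u => A (x₀, u)) B v := B.hasFDerivAt
    have h3 : fderiv ℝ A (x₀, v) (0, u) = B u := by
      simpa using congrArg (fun L : F →L[ℝ] W => L u) (h1.unique h2)
    exact h3
  have hder : mfderiv 𝓘(ℝ, F) 𝓘(ℝ, W) (fun q => θ q (Y q)) (c x₀)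
      (fundamentalField F (G := G) (mfderiv 𝓘(ℝ, E) 𝓘(ℝ, E) d y₀ η) (c x₀)) =
      fderiv ℝ A (x₀, v) (X x₀, 0) := by
    have hg : MDifferentiableAt 𝓘(ℝ, F) 𝓘(ℝ, W) (fun q => θ q (Y q)) (c x₀) :=
      (ContMDiffAt.comp (c x₀) hθ.contMDiffAt hYs).mdifferentiableAt (by simp)
    have h1 := mfderiv_comp_apply x₀ hg hc.mdifferentiableAt (X x₀)
    have h2 : HasFDerivAt (fun x => A (x, v)) _ x₀ :=
      HasFDerivAt.comp (g := A) x₀ hA (hasFDerivAt_prodMk_left x₀ v)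
    have h3 : (fun q => θ q (Y q)) ∘ c =ᶠ[𝓝 x₀] fun x => A (x, v) := by
      filter_upwards [hY] with x hx
      simp only [Function.comp_apply, hx, A]
    rw [(h2.congr_of_eventuallyEq h3).hasMFDerivAt.mfderiv] at h1
    rw [(eventually_fundamentalField hs hc hd hy₀ η).self_of_nhds]
    exact h1.symm
  have hsplit : fderiv ℝ A (x₀, v) (X x₀, D2 (0, η) (v, 0)) =
      fderiv ℝ A (x₀, v) (X x₀, 0) + A (x₀, D2 (v, 0) (0, η)) := by
    rw [← hAlin, ← map_add, hsymm]; simp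
  have hbr' : θ (c x₀) (VectorField.mlieBracket 𝓘(ℝ, F)
      (fundamentalField F (G := G) (mfderiv 𝓘(ℝ, E) 𝓘(ℝ, E) d y₀ η)) Y (c x₀)) =
      - A (x₀, D2 (v, 0) (0, η)) := by
    refine (congrArg (θ (c x₀)) hbr).trans ?_
    have h1 : VectorField.lieBracket (E := F) ℝ X (fun _ => v) x₀ = -D2 (v, 0) (0, η) := by
      rw [← hXd]; simp [VectorField.lieBracket]
    change θ (c x₀) (mfderiv 𝓘(ℝ, F) 𝓘(ℝ, F) c x₀
      (VectorField.lieBracket (E := F) ℝ X (fun _ => v) x₀ : F)) = _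
    rw [h1]
    let B : F →L[ℝ] W := (θ (c x₀)).comp (mfderiv 𝓘(ℝ, F) 𝓘(ℝ, F) c x₀)
    exact map_neg B _
  refine hleft.trans (hsplit.trans ?_)
  rw [← sub_neg_eq_add]
  exact (congrArg₂ (fun a b : W => a - b) hder hbr').symm

end Transport

/-! ### Equivariance under a connected group -/

theorem isLocallyConstant_of_hasMFDerivAt_zero {E : Type*} [NormedAddCommGroup E] [NormedSpace ℝ E]
    {G : Type*} [TopologicalSpace G] [ChartedSpace E G] [IsManifold 𝓘(ℝ, E) ∞ G]
    {W : Type*} [NormedAddCommGroup W] [NormedSpace ℝ W] {β : G → W}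
    (hβ : ∀ g, HasMFDerivAt 𝓘(ℝ, E) 𝓘(ℝ, W) β g (0 : E →L[ℝ] W)) : IsLocallyConstant β := by
  rw [IsLocallyConstant.iff_eventually_eq]
  intro g
  obtain ⟨d, d', y₀, rfl, hd⟩ := exists_isLocalParam (F := E) g
  obtain ⟨r, hr, hball⟩ := Metric.eventually_nhds_iff_ball.1 hd.eventually
  have hder : ∀ y ∈ Metric.ball y₀ r, HasFDerivAt (β ∘ d) (0 : E →L[ℝ] W) y := by
    intro y hy
    have h := (hβ (d y)).comp y (hball y hy).mdifferentiableAt.hasMFDerivAt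
    have h' : HasFDerivAt (β ∘ d) _ y := h.hasFDerivAt
    convert! h' using 1
  have hd' : Tendsto d' (𝓝 (d y₀)) (𝓝 y₀) := by
    have := hd.contMDiffAt_inv.continuousAt
    rwa [ContinuousAt, hd.inv_apply] at this
  filter_upwards [hd.right_inv, hd' (Metric.ball_mem_nhds y₀ hr)] with g hg hgr
  rw [← hg]
  refine Metric.isOpen_ball.is_const_of_fderiv_eq_zero (convex_ball y₀ r).isPreconnected
    (fun y hy => (hder y hy).differentiableAt.differentiableWithinAt)
    (fun y hy => (hder y hy).fderiv) hgr (Metric.mem_ball_self hr)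

section Equivariance

variable {E F : Type*} [NormedAddCommGroup E] [NormedSpace ℝ E]
  [NormedAddCommGroup F] [NormedSpace ℝ F] [CompleteSpace F]
  {G : Type*} [TopologicalSpace G] [ChartedSpace E G] [Group G] [LieGroup 𝓘(ℝ, E) ∞ G]
  {P : Type*} [TopologicalSpace P] [ChartedSpace F P] [IsManifold 𝓘(ℝ, F) ∞ P] [MulAction Gᵐᵒᵖ P]
  {n : ℕ} {ρ : G →* (EuclideanSpace ℝ (Fin n) →L[ℝ] EuclideanSpace ℝ (Fin n))}
  {ϖ : ∀ p : P, TangentSpace 𝓘(ℝ, F) p →L[ℝ] E × EuclideanSpace ℝ (Fin n)}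

/-- The function `g ↦ g · (R_g^* α)(w)`. -/
def transportedSolder (ρ : G →* (EuclideanSpace ℝ (Fin n) →L[ℝ] EuclideanSpace ℝ (Fin n)))
    (ϖ : ∀ p : P, TangentSpace 𝓘(ℝ, F) p →L[ℝ] E × EuclideanSpace ℝ (Fin n)) (p : P)
    (w : TangentSpace 𝓘(ℝ, F) p) (g : G) : EuclideanSpace ℝ (Fin n) :=
  ρ g (pullbackTranslation ϖ p w g).2

/-- By the product rule the derivative along `ξ` is the `ℝⁿ`-component of `𝓛_ξ̄ ϖ + ad_ξ ϖ`
evaluated on `w`. -/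
theorem hasMFDerivAt_transportedSolder_one (hs : IsSmoothRightAction (E := E) (F := F) G P)
    (hρ : ContMDiff 𝓘(ℝ, E)
      𝓘(ℝ, EuclideanSpace ℝ (Fin n) →L[ℝ] EuclideanSpace ℝ (Fin n)) ∞ ρ)
    (hϖ : IsGeneralisedCartanConnection ρ ϖ) (p : P) (w : TangentSpace 𝓘(ℝ, F) p) :
    HasMFDerivAt 𝓘(ℝ, E) 𝓘(ℝ, EuclideanSpace ℝ (Fin n)) (transportedSolder ρ ϖ p w) 1
      (0 : E →L[ℝ] EuclideanSpace ℝ (Fin n)) := by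
  obtain ⟨Y, hY, hYs, hγ, hγ'⟩ := exists_mfderiv_pullbackTranslation hs hϖ.smooth p w
  obtain ⟨d, d', y₀, hy₀, hd⟩ := exists_isLocalParam (F := E) (1 : G)
  have hρ1 : MDifferentiableAt 𝓘(ℝ, E)
      𝓘(ℝ, EuclideanSpace ℝ (Fin n) →L[ℝ] EuclideanSpace ℝ (Fin n)) ρ 1 :=
    hρ.mdifferentiable (by simp) 1
  have hγd : DifferentiableAt ℝ (pullbackTranslation ϖ p w ∘ d) y₀ :=
    (MDifferentiableAt.comp (I' := 𝓘(ℝ, E)) y₀ (by rw [hy₀]; exact hγ)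
      hd.mdifferentiableAt).differentiableAt
  have hρd : DifferentiableAt ℝ (ρ ∘ d) y₀ :=
    (MDifferentiableAt.comp (I' := 𝓘(ℝ, E)) y₀ (by rw [hy₀]; exact hρ1)
      hd.mdifferentiableAt).differentiableAt
  have hprod : HasFDerivAt (transportedSolder ρ ϖ p w ∘ d) _ y₀ :=
    hρd.hasFDerivAt.clm_apply hγd.hasFDerivAt.snd
  have hzero : HasFDerivAt (transportedSolder ρ ϖ p w ∘ d)
      (0 : E →L[ℝ] EuclideanSpace ℝ (Fin n)) y₀ := by
    convert! hprod using 1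
    symm
    ext1 η
    let ξ : GroupLieAlgebra 𝓘(ℝ, E) G := (mfderiv 𝓘(ℝ, E) 𝓘(ℝ, E) d y₀ η : E)
    have h1 : (fderiv ℝ (pullbackTranslation ϖ p w ∘ d) y₀ η : E × EuclideanSpace ℝ (Fin n)) =
        lieDerivativeOneForm (fundamentalField F ξ) ϖ Y p := by
      rw [← hγ', ← mfderiv_eq_fderiv]
      exact mfderiv_comp_apply_of_eq y₀ hγ hd.mdifferentiableAt hy₀ η
    have h2 : fderiv ℝ (ρ ∘ d) y₀ η = infinitesimalRep ρ ξ := by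
      rw [← mfderiv_eq_fderiv]
      exact mfderiv_comp_apply_of_eq y₀ hρ1 hd.mdifferentiableAt hy₀ η
    have h3 := congrArg Prod.snd (hϖ.equivariant ξ Y p hYs)
    have h4 : pullbackTranslation ϖ p w (d y₀) = ϖ p w := by
      rw [hy₀, pullbackTranslation_one]
    change ρ (d y₀) (fderiv ℝ (pullbackTranslation ϖ p w ∘ d) y₀ η).2 +
      fderiv ℝ (ρ ∘ d) y₀ η (pullbackTranslation ϖ p w (d y₀)).2 = 0
    rw [h1, h2, h4, hy₀, map_one]
    rw [hY] at h3
    simpa [semidirectBracket, semidirectInl] using h3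
  have h5 := HasMFDerivAt.comp (I' := 𝓘(ℝ, E)) (g := transportedSolder ρ ϖ p w ∘ d) (f := d')
    (d y₀) (by rw [hd.inv_apply]; exact hzero.hasMFDerivAt) hd.mdifferentiableAt_inv.hasMFDerivAt
  rw [← hy₀]
  have h6 : transportedSolder ρ ϖ p w =ᶠ[𝓝 (d y₀)] (transportedSolder ρ ϖ p w ∘ d) ∘ d' := by
    filter_upwards [hd.right_inv] with g hg
    simp only [Function.comp_apply, hg]
  convert! h5.congr_of_eventuallyEq h6 using 1

/-- Writing `x = g (g⁻¹ x)` expresses the function for `(p, w)` as `ρ g` applied to the function for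
`(p · g, dR_g w)` at `g⁻¹ x`, which reduces the claim to the identity. -/
theorem hasMFDerivAt_transportedSolder (hs : IsSmoothRightAction (E := E) (F := F) G P)
    (hρ : ContMDiff 𝓘(ℝ, E)
      𝓘(ℝ, EuclideanSpace ℝ (Fin n) →L[ℝ] EuclideanSpace ℝ (Fin n)) ∞ ρ)
    (hϖ : IsGeneralisedCartanConnection ρ ϖ) (p : P) (w : TangentSpace 𝓘(ℝ, F) p) (g : G) :
    HasMFDerivAt 𝓘(ℝ, E) 𝓘(ℝ, EuclideanSpace ℝ (Fin n)) (transportedSolder ρ ϖ p w) g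
      (0 : E →L[ℝ] EuclideanSpace ℝ (Fin n)) := by
  have h1 := hasMFDerivAt_transportedSolder_one hs hρ hϖ (p <• g)
    (mfderiv 𝓘(ℝ, F) 𝓘(ℝ, F) (fun q : P => q <• g) p w)
  have hmul : MDifferentiableAt 𝓘(ℝ, E) 𝓘(ℝ, E) (fun x : G => g⁻¹ * x) g :=
    (contMDiff_mul_left (n := ∞)).mdifferentiable (by simp) g
  have h1' : HasMFDerivAt 𝓘(ℝ, E) 𝓘(ℝ, EuclideanSpace ℝ (Fin n))
      (transportedSolder ρ ϖ (p <• g) (mfderiv 𝓘(ℝ, F) 𝓘(ℝ, F) (fun q : P => q <• g) p w))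
      (g⁻¹ * g) (0 : E →L[ℝ] EuclideanSpace ℝ (Fin n)) := by
    rw [inv_mul_cancel]; exact h1
  have h2 := HasMFDerivAt.comp g (f := fun x : G => g⁻¹ * x) h1' hmul.hasMFDerivAt
  have h3 := HasMFDerivAt.comp (I' := 𝓘(ℝ, EuclideanSpace ℝ (Fin n))) g (g := ρ g)
    (ρ g).hasFDerivAt.hasMFDerivAt h2
  have h4 : transportedSolder ρ ϖ p w = ρ g ∘ (transportedSolder ρ ϖ (p <• g)
      (mfderiv 𝓘(ℝ, F) 𝓘(ℝ, F) (fun q : P => q <• g) p w) ∘ fun x : G => g⁻¹ * x) := by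
    funext x
    simp only [transportedSolder, Function.comp_apply]
    rw [← pullbackTranslation_mul hs, mul_inv_cancel_left, ← mul_apply_eq_comp,
      ← map_mul, mul_inv_cancel_left]
  let D : E →L[ℝ] E := mfderiv 𝓘(ℝ, E) 𝓘(ℝ, E) (fun x : G => g⁻¹ * x) g
  have h5 : (ρ g).comp ((0 : E →L[ℝ] EuclideanSpace ℝ (Fin n)).comp D) = 0 := by simp
  rw [h4, ← h5]
  exact h3

theorem isGroupEquivariantSolder_of_connectedSpace [ConnectedSpace G]
    (hs : IsSmoothRightAction (E := E) (F := F) G P)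
    (hρ : ContMDiff 𝓘(ℝ, E)
      𝓘(ℝ, EuclideanSpace ℝ (Fin n) →L[ℝ] EuclideanSpace ℝ (Fin n)) ∞ ρ)
    (hϖ : IsGeneralisedCartanConnection ρ ϖ) : IsGroupEquivariantSolder ρ ϖ := by
  intro g p w
  have h := (isLocallyConstant_of_hasMFDerivAt_zero
    (hasMFDerivAt_transportedSolder hs hρ hϖ p w)).apply_eq_of_preconnectedSpace g 1
  simp only [transportedSolder, pullbackTranslation_one, map_one] at h
  change (pullbackTranslation ϖ p w g).2 = _
  have h' := congrArg (ρ g⁻¹) h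
  rw [← mul_apply_eq_comp, ← map_mul, inv_mul_cancel, map_one] at h'
  exact h'

end Equivariance

/-! ### Principal isotropy groups -/

/-- An equivariant Cartan connection forces principal isotropy groups to act trivially on `ℝⁿ`. -/
theorem isotropyGroup_le_ker_of_isPrincipalPoint
    {E F : Type*} [NormedAddCommGroup E] [NormedSpace ℝ E] [FiniteDimensional ℝ E]
    [NormedAddCommGroup F] [NormedSpace ℝ F] [FiniteDimensional ℝ F]
    {G : Type*} [TopologicalSpace G] [ChartedSpace E G] [Group G]
    [LieGroup 𝓘(ℝ, E) ∞ G]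
    {P : Type*} [TopologicalSpace P] [T2Space P] [ChartedSpace F P] [IsManifold 𝓘(ℝ, F) ∞ P]
    [MulAction Gᵐᵒᵖ P]
    (hs : IsSmoothRightAction (E := E) (F := F) G P) (hp : IsProperRightAction G P) {n : ℕ}
    {ρ : G →* (EuclideanSpace ℝ (Fin n) →L[ℝ] EuclideanSpace ℝ (Fin n))}
    {ϖ : ∀ p : P, TangentSpace 𝓘(ℝ, F) p →L[ℝ] E × EuclideanSpace ℝ (Fin n)}
    (hϖ : IsGeneralisedCartanConnection ρ ϖ) (hequiv : IsGroupEquivariantSolder ρ ϖ)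
    {p : P} (hprin : IsPrincipalPoint G p) : isotropyGroup G p ≤ ρ.ker := by
  have : IsTopologicalGroup G := topologicalGroup_of_lieGroup 𝓘(ℝ, E) ∞
  have : LocallyCompactSpace P := ChartedSpace.locallyCompactSpace F P
  obtain ⟨f₀, hf₀, hf₀p, hf₀d⟩ := exists_map_with_mfderiv p
    ((ContinuousLinearMap.fst ℝ E (EuclideanSpace ℝ (Fin n))).comp (ϖ p))
  have hB₀ : ∀ ξ : GroupLieAlgebra 𝓘(ℝ, E) G,
      mfderiv 𝓘(ℝ, F) 𝓘(ℝ, E) f₀ p (fundamentalField F ξ p) = ξ := fun ξ =>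
    (hf₀d _).trans (congrArg Prod.fst (hϖ.normalised ξ p))
  obtain ⟨U₀, hU₀, W₀, hW₀, hinj₀⟩ := exists_nhds_orbit_injective hs hf₀ hB₀
  have : Finite (isotropyGroup G p) := finite_isotropyGroup hp p hW₀ fun u hu hup =>
    hinj₀ p (mem_of_mem_nhds hU₀) u hu 1 (mem_of_mem_nhds hW₀) (by simp [hup])
  obtain ⟨f, hf, hfp, hB, hfequiv⟩ := exists_equivariant_map hs p hf₀ hf₀p hB₀
  -- Local injectivity is needed again for the averaged `f`: the one for `f₀` served only to prove
  -- finiteness, which the averaging requires.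
  obtain ⟨U, hU, W, hW, hinj⟩ := exists_nhds_orbit_injective hs hf hB
  have hfix : ∀ h ∈ isotropyGroup G p, ∀ᶠ s in 𝓝 p, f s = 0 → s <• h = s := by
    intro h hh
    filter_upwards [eventually_isotropyGroup_le hp hs.continuous hU hW hinj hfequiv] with s hs hfs
    rw [← mem_isotropyGroup, hprin.isotropyGroup_eq (hs hfs)]
    exact hh
  have hsurj : Function.Surjective (mfderiv 𝓘(ℝ, F) 𝓘(ℝ, E) f p) := fun ξ => ⟨_, hB ξ⟩
  have key : ∀ h ∈ isotropyGroup G p, ρ h⁻¹ = 1 := by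
    intro h hh
    ext1 u
    obtain ⟨v, hv⟩ := (hϖ.nondegenerate p).2 (0, u)
    -- The differential of the averaged `f` need not kill `v`. Subtracting the fundamental vector of
    -- `ξ = df(v)` moves `v` into the kernel without changing its `ℝⁿ`-component, because `ϖ(ξ̄) =
    -- (ξ, 0)`.
    let ξ : GroupLieAlgebra 𝓘(ℝ, E) G := (mfderiv 𝓘(ℝ, F) 𝓘(ℝ, E) f p v : E)
    have hv1 : mfderiv 𝓘(ℝ, F) 𝓘(ℝ, E) f p (v - fundamentalField F ξ p) = 0 := by
      refine (map_sub _ _ _).trans ?_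
      rw [hB ξ]
      exact sub_self _
    have hv2 : (ϖ p (v - fundamentalField F ξ p)).2 = u := by
      rw [map_sub, hv, hϖ.normalised]
      simp [semidirectInl]
    have h1 := hequiv h p (v - fundamentalField F ξ p)
    rw [oneForm_congr ϖ (mem_isotropyGroup.1 hh)
      (mfderiv_translation_eq_self hs hf hfp hsurj (hfix h hh) _ hv1), hv2] at h1
    exact h1.symm
  intro h hh
  rw [MonoidHom.mem_ker, ← inv_inv h]
  exact key _ (inv_mem hh)

end

theorem mainTheorem3
    {E F : Type*} [NormedAddCommGroup E] [NormedSpace ℝ E] [FiniteDimensional ℝ E]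
    [NormedAddCommGroup F] [NormedSpace ℝ F] [FiniteDimensional ℝ F]
    {G : Type*} [TopologicalSpace G] [T2Space G] [ChartedSpace E G] [Group G]
    [LieGroup 𝓘(ℝ, E) ∞ G]
    {P : Type*} [TopologicalSpace P] [T2Space P] [ChartedSpace F P] [IsManifold 𝓘(ℝ, F) ∞ P]
    [MulAction Gᵐᵒᵖ P]
    (hsmooth : IsSmoothRightAction (E := E) (F := F) G P)
    (hproper : IsProperRightAction G P)
    {n : ℕ}
    (ρ : G →* (EuclideanSpace ℝ (Fin n) →L[ℝ] EuclideanSpace ℝ (Fin n)))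
    (hρ : ContMDiff 𝓘(ℝ, E)
      𝓘(ℝ, EuclideanSpace ℝ (Fin n) →L[ℝ] EuclideanSpace ℝ (Fin n)) ∞ ρ)
    (ϖ : ∀ p : P, TangentSpace 𝓘(ℝ, F) p →L[ℝ] E × EuclideanSpace ℝ (Fin n))
    (hϖ : IsGeneralisedCartanConnection ρ ϖ)
    (hequiv : ConnectedSpace G ∨ IsGroupEquivariantSolder ρ ϖ) :
    (∀ p : P, IsPrincipalPoint G p → isotropyGroup G p ≤ ρ.ker) ∧
    (Function.Injective ρ → ∀ p : P, IsPrincipalPoint G p → isotropyGroup G p = ⊥) := by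
  have hle : ∀ p : P, IsPrincipalPoint G p → isotropyGroup G p ≤ ρ.ker := fun p hp =>
    have : CompleteSpace F := FiniteDimensional.complete ℝ F
    isotropyGroup_le_ker_of_isPrincipalPoint hsmooth hproper hϖ
      (hequiv.elim (fun _ => isGroupEquivariantSolder_of_connectedSpace hsmooth hρ hϖ) id) hp
  exact ⟨hle, fun hinj p hp => le_bot_iff.1 ((hle p hp).trans ((ρ.ker_eq_bot_iff).2 hinj).le)⟩
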